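/- **Theorem 1.1 (uniqueness for the 1D gas–disk system).** Let $\phi_0\in L^1(\mathbb R)\cap L^\infty(\mathbb R)$, let $F:\mathbb R\times[0,\infty)\to\mathbb R$, $F=F(x,t)$, be Lipschitz in $x$ with a Lipschitz constant independent of $t$, and let $p_0\in\mathbb R$. Then there is at most one solution $(\eta,p,f)$ of the gas–disk system below such that $p$ is locally Lipschitz on $[0,\infty)$: if $(\eta_1,p_1,f_1)$ and $(\eta_2,p_2,f_2)$ are two such solutions, then $\eta_1=\eta_2$ and $p_1=p_2$ on $[0,\infty)$, and for every $t\ge 0$, $f_1(x,v,t)=f_2(x,v,t)$ for almost every $(x,v)\in\mathbb R^2$. (No closeness to an equilibrium is assumed.) *The system.* The unknowns are the position $\eta(t)$ and the velocity $p(t)$ of the disk and the gas density $f(x,v,t)$, for $x,v\in\mathbb R$, $t\ge0$. The function $f$ is measurable and locally integrable on $\mathbb R\times\mathbb R\times[0,\infty)$. The gas satisfies $$\partial_t f+v\,\partial_x f=0\quad (x\ne\eta(t)),\qquad f(x,v,0)=\phi_0(v),$$ where the initial condition holds for a.e. $(x,v)$ and the equation means that for a.e. $(y,v)$ and all $0\le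 s\le t$ such that $y+\tau v\neq\eta(\tau)$ for all $\tau\in[s,t]$ one has $f(y+sv,v,s)=f(y+tv,v,t)$. Write $$f^{\pm}(\eta(t),v,t)=\lim_{\varepsilon\to0^+}f(\eta(t)\pm\varepsilon v,v,t\pm\varepsilon)$$ for the post- and precollisional densities at the disk; these limits exist for a.e. $(t,v)$ with $t>0$. Trajectories arriving at the disk with $v<p(t)$, or leaving it with $v>p(t)$, lie to the right of the disk (index $R$), the others to its left (index $L$): $f^-_R$ and $f^+_L$ are the traces for $v<p(t)$, and $f^+_R$ and $f^-_L$ those for $v>p(t)$. For a.e. $t>0$ the functions $v\mapsto (v-p(t))f^-(\eta(t),v,t)$ and $v\mapsto (v-p(t))^2f^-(\eta(t),v,t)$ are integrable on $\mathbb R$, and for a.e. $(t,v)$ with $t>0$, $$f^+_R(\eta(t),v,t)=2e^{-(v-p(t))^2}\int_{-\infty}^{p(t)}(p(t)-w)f^-_R(\eta(t),w,t)\,dw,\quad v>p(t),$$ $$f^+_L(\eta(t),v,t)=2e^{-(p(t)-v)^2}\int_{p(t)}^{\infty}(w-p(t))f^-_L(\eta(t),w,t)\,dw,\quad v<p(t).$$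 The disk satisfies $\eta(0)=0$, $\dot\eta(t)=p(t)$ for all $t\ge0$, $p(0)=p_0$ and, for a.e. $t>0$, $\dot p(t)=F(\eta(t),t)-G_p(t)$ with $G_p=G_{p,R}-G_{p,L}$ and $$G_{p,R}(t)=\int_{-\infty}^{p(t)}(p(t)-v)^2f^-_R(\eta(t),v,t)\,dv+\int_{p(t)}^{\infty}(v-p(t))^2f^+_R(\eta(t),v,t)\,dv,$$ $$G_{p,L}(t)=\int_{-\infty}^{p(t)}(p(t)-v)^2f^+_L(\eta(t),v,t)\,dv+\int_{p(t)}^{\infty}(v-p(t))^2f^-_L(\eta(t),v,t)\,dv.$$ -/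

import Mathlib

open MeasureTheory Set Filter Topology

namespace GasDisk

/-- The precollisional density `f⁻(η(t), v, t)` at the disk: the limit, backwards in time along the
free trajectory of velocity `v` arriving at the disk at time `t`. For `v < p(t)` the trajectory
arrives from the right of the disk (so this is `f⁻_R`), for `v > p(t)` from the left (`f⁻_L`). -/
noncomputable def preTrace (η : ℝ → ℝ) (f : ℝ → ℝ → ℝ → ℝ) (t v : ℝ) : ℝ :=
  limUnder (𝓝[>] (0 : ℝ)) (fun ε => f (η t - ε * v) v (t - ε))

/-- The postcollisional density `f⁺(η(t), v, t)` at the disk: the limit, forwards in time along the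
free trajectory of velocity `v` leaving the disk at time `t`. For `v > p(t)` the trajectory
leaves to the right of the disk (so this is `f⁺_R`), for `v < p(t)` to the left (`f⁺_L`). -/
noncomputable def postTrace (η : ℝ → ℝ) (f : ℝ → ℝ → ℝ → ℝ) (t v : ℝ) : ℝ :=
  limUnder (𝓝[>] (0 : ℝ)) (fun ε => f (η t + ε * v) v (t + ε))

/-- Drag force due to the gas on the right of the disk. -/
noncomputable def dragR (η p : ℝ → ℝ) (f : ℝ → ℝ → ℝ → ℝ) (t : ℝ) : ℝ :=
  (∫ v in Iio (p t), (p t - v) ^ 2 * preTrace η f t v) +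
    ∫ v in Ioi (p t), (v - p t) ^ 2 * postTrace η f t v

/-- Drag force due to the gas on the left of the disk. -/
noncomputable def dragL (η p : ℝ → ℝ) (f : ℝ → ℝ → ℝ → ℝ) (t : ℝ) : ℝ :=
  (∫ v in Iio (p t), (p t - v) ^ 2 * postTrace η f t v) +
    ∫ v in Ioi (p t), (v - p t) ^ 2 * preTrace η f t v

/-- Total drag force. -/
noncomputable def drag (η p : ℝ → ℝ) (f : ℝ → ℝ → ℝ → ℝ) (t : ℝ) : ℝ :=
  dragR η p f t - dragL η p f t

/-- `(η, p, f)` solves, on the time interval `[0, ∞)`, the gas-disk system with initial gas density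
`φ₀`, external force `F(x, t)` and initial disk velocity `p₀`. The density is `f x v t`. Only the
values at times `t ≥ 0` matter. -/
structure IsSolution (φ₀ : ℝ → ℝ) (F : ℝ → ℝ → ℝ) (p₀ : ℝ)
    (η p : ℝ → ℝ) (f : ℝ → ℝ → ℝ → ℝ) : Prop where
  /-- `f` is a measurable function of `(x, v, t)` -/
  measurable : Measurable (fun z : ℝ × ℝ × ℝ => f z.1 z.2.1 z.2.2)
  /-- `f` is locally integrable on `ℝ × ℝ × [0, ∞)` -/
  integrable : ∀ R : ℝ, IntegrableOn (fun z : ℝ × ℝ × ℝ => f z.1 z.2.1 z.2.2)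
    (Icc (-R) R ×ˢ Icc (-R) R ×ˢ Icc 0 R)
  /-- initial density of the gas -/
  initial : ∀ᵐ z : ℝ × ℝ, f z.1 z.2 0 = φ₀ z.2
  /-- free transport `∂ₜ f + v ∂ₓ f = 0` away from the disk: on almost every free trajectory
  `τ ↦ (y + τ v, v)`, the density does not change during a time interval in which the trajectory
  does not meet the disk -/
  transport : ∀ᵐ z : ℝ × ℝ, ∀ s t : ℝ, 0 ≤ s → s ≤ t →
    (∀ τ ∈ Icc s t, z.1 + τ * z.2 ≠ η τ) → f (z.1 + s * z.2) z.2 s = f (z.1 + t * z.2) z.2 t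
  /-- the one-sided limits of the density at the disk exist -/
  hasTraces : ∀ᵐ z : ℝ × ℝ, 0 < z.1 →
    Tendsto (fun ε => f (η z.1 - ε * z.2) z.2 (z.1 - ε)) (𝓝[>] 0) (𝓝 (preTrace η f z.1 z.2)) ∧
    Tendsto (fun ε => f (η z.1 + ε * z.2) z.2 (z.1 + ε)) (𝓝[>] 0) (𝓝 (postTrace η f z.1 z.2))
  /-- the mass fluxes into the disk are finite -/
  flux_integrable : ∀ᵐ t : ℝ, 0 < t → Integrable (fun v => (v - p t) * preTrace η f t v)
  /-- the momentum fluxes into the disk are finite -/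
  momentum_integrable : ∀ᵐ t : ℝ, 0 < t → Integrable (fun v => (v - p t) ^ 2 * preTrace η f t v)
  /-- diffusive boundary condition on the right of the disk; here `z = (t, v)` -/
  boundaryR : ∀ᵐ z : ℝ × ℝ, 0 < z.1 → p z.1 < z.2 →
    postTrace η f z.1 z.2 = 2 * Real.exp (-(z.2 - p z.1) ^ 2) *
      ∫ w in Iio (p z.1), (p z.1 - w) * preTrace η f z.1 w
  /-- diffusive boundary condition on the left of the disk; here `z = (t, v)` -/
  boundaryL : ∀ᵐ z : ℝ × ℝ, 0 < z.1 → z.2 < p z.1 →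
    postTrace η f z.1 z.2 = 2 * Real.exp (-(p z.1 - z.2) ^ 2) *
      ∫ w in Ioi (p z.1), (w - p z.1) * preTrace η f z.1 w
  /-- initial position of the disk -/
  position_zero : η 0 = 0
  /-- `η' = p` on `[0, ∞)` -/
  position_deriv : ∀ t : ℝ, 0 ≤ t → HasDerivWithinAt η (p t) (Ici 0) t
  /-- initial velocity of the disk -/
  velocity_zero : p 0 = p₀
  /-- `p` is locally Lipschitz on `[0, ∞)` -/
  velocity_lipschitz : LocallyLipschitzOn (Ici 0) p
  /-- equation of motion `p' = F(η, t) - G`; a locally Lipschitz `p` is differentiable only at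
  almost every time, and is the integral of its derivative -/
  velocity_deriv : ∀ᵐ t : ℝ, 0 < t → HasDerivAt p (F (η t) t - drag η p f t) t

end GasDisk

/-! Consider the gas on the right of the disk. A particle arriving at time `t` with velocity `v < p
t` either left the disk at a last earlier time `τ`, and then `v` is the mean disk velocity over `[τ,
t]`, or has never collided. Free transport preserves the density, so the precollisional density is a
Gaussian times the inflow `J τ` in the first case and `φ v` in the second (`IsRegular.preTrace_eq`).
Hence `J` solves the integral equation `J = moment φ p J T 1`, and the drag is a second moment plus
a constant times `J`. If these moments depend on `p` in a Lipschitz way, Grönwall's inequality gives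
uniqueness of `p`.

The obstacle is the last collision time `lastLeave p T t v`, which can jump in `v` and in `p` when
trajectories graze the disk. Two facts replace its continuity. First, the Lipschitz map `velTo p t`
is a left inverse of it, so Lebesgue measure in `v`, transported to collision times, has density at
most the Lipschitz constant of `p` (`map_lastHit_le`); integrating `exp (l * τ)` then gains a factor
`1 / l`. Second, it is monotone in `v`, and a uniform change of `velTo` by `Δ` is dominated by a
shift of `v` by `Δ`; so its change is of order `Δ` in L¹ (`integral_abs_sub_le_of_shift`).

To compare `J₁ τ₁` with `J₂ τ₂` at different collision times, one flux must be Lipschitz in time;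
`exists_lipschitz_flux` proves this by absorbing a weighted supremum of increments, and
`exists_moment_stability` absorbs the difference of the fluxes in the same way. The a priori
integrability of the flux comes from fast outgoing gas (`IsRightGas.integrableOn_inflow`). The left
side follows by reflection. Once the disk motions and fluxes agree, the densities agree along almost
every trajectory (`ae_density_eq`). -/

namespace GasDisk

/-! ### Mean velocities -/

/-- The mean of `p` over the time interval between `τ` and `t`. -/
noncomputable def meanVel (p : ℝ → ℝ) (τ t : ℝ) : ℝ :=
  ∫ θ in (0 : ℝ)..1, p (τ + θ * (t - τ))

@[simp] lemma meanVel_self (p : ℝ → ℝ) (t : ℝ) : meanVel p t t = p t := by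
  simp [meanVel]

lemma intervalIntegrable_meanVel {p : ℝ → ℝ} (hp : Continuous p) (τ t a b : ℝ) :
    IntervalIntegrable (fun θ => p (τ + θ * (t - τ))) volume a b :=
  (by fun_prop : Continuous fun θ => p (τ + θ * (t - τ))).intervalIntegrable _ _

/-- Averaging over the parameter interval `[0, 1]` avoids dividing by `t - τ`: the mean stays
Lipschitz up to `τ = t`, and this identity recovers the displacement. -/
lemma mul_meanVel (p : ℝ → ℝ) (τ t : ℝ) : (t - τ) * meanVel p τ t = ∫ s in τ..t, p s := by
  unfold meanVel
  have h := intervalIntegral.mul_integral_comp_add_mul (a := 0) (b := 1) (f := p) (t - τ) τ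
  simp only [mul_comm _ (t - τ)]
  rw [h]
  simp

lemma abs_meanVel_sub_le_of_bound {p q : ℝ → ℝ} (hp : Continuous p) (hq : Continuous q)
    {τ t τ' t' D : ℝ}
    (h : ∀ θ ∈ Icc (0 : ℝ) 1, |p (τ + θ * (t - τ)) - q (τ' + θ * (t' - τ'))| ≤ D) :
    |meanVel p τ t - meanVel q τ' t'| ≤ D := by
  unfold meanVel
  rw [← intervalIntegral.integral_sub (intervalIntegrable_meanVel hp ..)
    (intervalIntegrable_meanVel hq ..)]
  have := intervalIntegral.norm_integral_le_of_norm_le_const (a := 0) (b := 1) (C := D)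
    (f := fun θ => p (τ + θ * (t - τ)) - q (τ' + θ * (t' - τ'))) (fun θ hθ => by
      rw [uIoc_of_le zero_le_one] at hθ
      exact h θ ⟨hθ.1.le, hθ.2⟩)
  simpa using this

lemma abs_meanVel_sub_le {p : ℝ → ℝ} {L : NNReal} (hp : LipschitzWith L p) (τ t τ' t' : ℝ) :
    |meanVel p τ t - meanVel p τ' t'| ≤ L * (|τ - τ'| + |t - t'|) := by
  refine abs_meanVel_sub_le_of_bound hp.continuous hp.continuous fun θ hθ => ?_
  have h1 := hp.dist_le_mul (τ + θ * (t - τ)) (τ' + θ * (t' - τ'))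
  rw [Real.dist_eq, Real.dist_eq] at h1
  refine h1.trans (mul_le_mul_of_nonneg_left ?_ L.2)
  have h2 : τ + θ * (t - τ) - (τ' + θ * (t' - τ')) = (1 - θ) * (τ - τ') + θ * (t - t') := by ring
  rw [h2]
  refine (abs_add_le _ _).trans ?_
  rw [abs_mul, abs_mul, abs_of_nonneg hθ.1, abs_of_nonneg (sub_nonneg.2 hθ.2)]
  have := abs_nonneg (τ - τ')
  have := abs_nonneg (t - t')
  nlinarith [hθ.1, hθ.2]

lemma abs_meanVel_sub_meanVel_le {p q : ℝ → ℝ} (hp : Continuous p) (hq : Continuous q)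
    {τ t D : ℝ} (h0 : 0 ≤ τ) (hτ : τ ≤ t) (h : ∀ s ∈ Icc 0 t, |p s - q s| ≤ D) :
    |meanVel p τ t - meanVel q τ t| ≤ D := by
  refine abs_meanVel_sub_le_of_bound hp hq fun θ hθ => h _ ⟨?_, ?_⟩
  · have := mul_nonneg hθ.1 (sub_nonneg.2 hτ); linarith
  · nlinarith [hθ.2]

lemma abs_meanVel_le {p : ℝ → ℝ} (hp : Continuous p) {P : ℝ} (h : ∀ s, |p s| ≤ P) (τ t : ℝ) :
    |meanVel p τ t| ≤ P := by
  have := abs_meanVel_sub_le_of_bound (p := p) (q := 0) (τ := τ) (t := t) (τ' := 0) (t' := 0)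
    (D := P) hp continuous_zero (fun θ _ => by simpa using h _)
  simpa [meanVel] using this

/-- The velocity of the free trajectory which leaves the disk at time `τ` and meets it again at
time `t`, continued by `p t` to `τ ≥ t`. -/
noncomputable def velTo (p : ℝ → ℝ) (t τ : ℝ) : ℝ := meanVel p (min τ t) t

lemma velTo_of_le (p : ℝ → ℝ) {t τ : ℝ} (h : t ≤ τ) : velTo p t τ = p t := by
  simp [velTo, min_eq_right h]

lemma velTo_of_ge (p : ℝ → ℝ) {t τ : ℝ} (h : τ ≤ t) : velTo p t τ = meanVel p τ t := by
  simp [velTo, min_eq_left h]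

lemma lipschitzWith_velTo {p : ℝ → ℝ} {L : NNReal} (hp : LipschitzWith L p) (t : ℝ) :
    LipschitzWith L (velTo p t) := by
  refine LipschitzWith.of_dist_le_mul fun τ τ' => ?_
  rw [Real.dist_eq, Real.dist_eq]
  refine (abs_meanVel_sub_le hp _ _ _ _).trans ?_
  refine mul_le_mul_of_nonneg_left ?_ L.2
  simp only [sub_self, abs_zero, add_zero]
  simpa using abs_min_sub_min_le_max τ t τ' t

/-- The factor 2 appears because both endpoints of the averaging interval, `min τ t` and `t`, move
with `t`. -/
lemma abs_velTo_sub_le {p : ℝ → ℝ} {L : NNReal} (hp : LipschitzWith L p) (t t' τ : ℝ) :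
    |velTo p t τ - velTo p t' τ| ≤ 2 * L * |t - t'| := by
  refine (abs_meanVel_sub_le hp _ _ _ _).trans ?_
  have : |min τ t - min τ t'| ≤ |t - t'| := by
    simpa using abs_min_sub_min_le_max τ t τ t'
  have := mul_le_mul_of_nonneg_left this L.2
  change (L : ℝ) * _ ≤ (L : ℝ) * _ at this
  linarith

lemma abs_velTo_sub_velTo_le {p q : ℝ → ℝ} (hp : Continuous p) (hq : Continuous q)
    {τ t D : ℝ} (h0 : 0 ≤ τ) (ht : 0 ≤ t) (h : ∀ s ∈ Icc 0 t, |p s - q s| ≤ D) :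
    |velTo p t τ - velTo q t τ| ≤ D :=
  abs_meanVel_sub_meanVel_le hp hq (le_min h0 ht) (min_le_right _ _) h

lemma abs_velTo_le {p : ℝ → ℝ} (hp : Continuous p) {P : ℝ} (h : ∀ s, |p s| ≤ P) (t τ : ℝ) :
    |velTo p t τ| ≤ P :=
  abs_meanVel_le hp h _ _

/-! ### Last hitting times -/

/-- The last time in `[0, T]` at which `U ≤ v`, and `0` if there is none. -/
noncomputable def lastHit (U : ℝ → ℝ) (T v : ℝ) : ℝ :=
  sSup (insert 0 {τ | τ ∈ Icc 0 T ∧ U τ ≤ v})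

section LastHit

variable {U U₁ U₂ : ℝ → ℝ} {T v w s D : ℝ}

lemma lastHit_set_subset (hT : 0 ≤ T) : insert 0 {τ | τ ∈ Icc 0 T ∧ U τ ≤ v} ⊆ Icc 0 T := by
  rintro x (rfl | hx)
  · exact ⟨le_rfl, hT⟩
  · exact hx.1

lemma bddAbove_lastHit_set (hT : 0 ≤ T) : BddAbove (insert 0 {τ | τ ∈ Icc 0 T ∧ U τ ≤ v}) :=
  bddAbove_Icc.mono (lastHit_set_subset hT)

lemma lastHit_nonneg (hT : 0 ≤ T) : 0 ≤ lastHit U T v :=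
  le_csSup (bddAbove_lastHit_set hT) (mem_insert _ _)

lemma lastHit_le (hT : 0 ≤ T) : lastHit U T v ≤ T :=
  csSup_le (insert_nonempty _ _) fun _ hx => (lastHit_set_subset hT hx).2

lemma le_lastHit (hs : s ∈ Icc 0 T) (h : U s ≤ v) : s ≤ lastHit U T v :=
  le_csSup (bddAbove_lastHit_set (hs.1.trans hs.2)) (Or.inr ⟨hs, h⟩)

lemma lt_of_lastHit_lt (h0 : 0 ≤ s) (hs : s ≤ T) (h : lastHit U T v < s) : v < U s := by
  by_contra! hc
  exact absurd (le_lastHit ⟨h0, hs⟩ hc) (not_le.2 h)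

lemma lastHit_le_of_forall (hs : 0 ≤ s) (h : ∀ τ ∈ Icc 0 T, U τ ≤ v → τ ≤ s) :
    lastHit U T v ≤ s := by
  refine csSup_le (insert_nonempty _ _) ?_
  rintro x (rfl | hx)
  · exact hs
  · exact h x hx.1 hx.2

lemma lastHit_eq_zero (hT : 0 ≤ T) (h : ∀ τ ∈ Icc 0 T, v < U τ) : lastHit U T v = 0 :=
  le_antisymm (lastHit_le_of_forall le_rfl fun τ hτ hle => absurd (h τ hτ) (not_lt.2 hle))
    (lastHit_nonneg hT)

lemma lastHit_le_lastHit (hT : 0 ≤ T) (h : ∀ τ ∈ Icc 0 T, U₂ τ ≤ v → U₁ τ ≤ w) :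
    lastHit U₂ T v ≤ lastHit U₁ T w :=
  lastHit_le_of_forall (lastHit_nonneg hT) fun τ hτ hle => le_lastHit hτ (h τ hτ hle)

lemma monotone_lastHit (hT : 0 ≤ T) : Monotone (lastHit U T) :=
  fun _ _ hvw => lastHit_le_lastHit hT fun _ _ h => h.trans hvw

/-- A uniform error in `U` is traded for a shift of the level `v`. This is the only sense in which
the hitting time is stable, as it may jump. -/
lemma lastHit_le_shift (hT : 0 ≤ T) (h : ∀ τ ∈ Icc 0 T, |U₁ τ - U₂ τ| ≤ D) (v : ℝ) :
    lastHit U₂ T v ≤ lastHit U₁ T (v + D) :=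
  lastHit_le_lastHit hT fun τ hτ hle => by
    have := (abs_le.1 (h τ hτ)).2
    linarith

lemma apply_lastHit_le (hU : Continuous U) (hpos : 0 < lastHit U T v) :
    U (lastHit U T v) ≤ v := by
  have hT : 0 ≤ T := by
    by_contra! hT
    have : lastHit U T v = 0 := by
      unfold lastHit
      rw [Icc_eq_empty (not_le.2 hT)]
      simp
    linarith
  set A := insert 0 {τ | τ ∈ Icc 0 T ∧ U τ ≤ v} with hA
  have hclosed : IsClosed A := by
    rw [hA, insert_eq]
    exact isClosed_singleton.union (isClosed_Icc.inter (isClosed_le hU continuous_const))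
  have := hclosed.csSup_mem (insert_nonempty _ _) (bddAbove_lastHit_set hT)
  rcases this with h | h
  · exact absurd h hpos.ne'
  · exact h.2

/-- If the value were below `v`, the intermediate value theorem would give a later time with `U =
v`, against maximality. -/
lemma apply_lastHit_eq (hU : Continuous U) (hpos : 0 < lastHit U T v) (hv : v < U T) :
    U (lastHit U T v) = v := by
  have hT : 0 ≤ T := by
    by_contra! hT
    have : lastHit U T v = 0 := by
      unfold lastHit
      rw [Icc_eq_empty (not_le.2 hT)]
      simp
    linarith
  have hle := apply_lastHit_le hU hpos
  obtain ⟨s, hs, hsv⟩ := intermediate_value_Icc (lastHit_le (U := U) (v := v) hT)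
    hU.continuousOn ⟨hle, hv.le⟩
  have h1 : s ≤ lastHit U T v := le_lastHit ⟨hpos.le.trans hs.1, hs.2⟩ hsv.le
  rw [← le_antisymm h1 hs.1, hsv]

end LastHit

/-! ### Change of variables from arrival velocity to last collision time -/

section VelTo

variable {p : ℝ → ℝ} {L : NNReal} {T t v : ℝ}

lemma lastHit_velTo_le (ht : 0 ≤ t) (hv : v < p t) : lastHit (velTo p t) T v ≤ t :=
  lastHit_le_of_forall ht fun τ _ hle => by
    by_contra! h
    rw [velTo_of_le p h.le] at hle
    linarith

lemma velTo_lastHit_eq (hp : LipschitzWith L p) (htT : t ≤ T) (hv : v < p t)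
    (hpos : 0 < lastHit (velTo p t) T v) : velTo p t (lastHit (velTo p t) T v) = v :=
  apply_lastHit_eq (lipschitzWith_velTo hp t).continuous hpos (by rwa [velTo_of_le p htT])

lemma lastHit_velTo_lt (hp : LipschitzWith L p) (ht : 0 < t) (htT : t ≤ T) (hv : v < p t) :
    lastHit (velTo p t) T v < t := by
  refine lt_of_le_of_ne (lastHit_velTo_le ht.le hv) fun h => ?_
  have := velTo_lastHit_eq (T := T) hp htT hv (by rwa [h])
  rw [h, velTo_of_le p le_rfl] at this
  exact hv.ne' this

/-- The velocities arriving at time `t` from the right after an earlier collision. -/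
def hitSet (p : ℝ → ℝ) (T t : ℝ) : Set ℝ := {v | v < p t ∧ 0 < lastHit (velTo p t) T v}

lemma measurable_lastHit {U : ℝ → ℝ} (hT : 0 ≤ T) : Measurable (lastHit U T) :=
  (monotone_lastHit hT).measurable

lemma measurableSet_hitSet (hT : 0 ≤ T) : MeasurableSet (hitSet p T t) :=
  measurableSet_Iio.inter (measurableSet_lt measurable_const (measurable_lastHit hT))

/-- On `hitSet`, `velTo p t` undoes the hitting time, so the velocities whose hitting time lies in
`N` belong to the Lipschitz image of `N ∩ Icc 0 t`, whose length is at most `L` times that of the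
set. No lower bound on a derivative is needed. -/
lemma map_lastHit_le (hp : LipschitzWith L p) (ht : 0 ≤ t) (htT : t ≤ T) :
    (volume.restrict (hitSet p T t)).map (lastHit (velTo p t) T) ≤
      (L : ENNReal) • volume.restrict (Icc 0 t) := by
  have hT := ht.trans htT
  refine Measure.le_iff.2 fun N hN => ?_
  rw [Measure.map_apply (measurable_lastHit hT) hN,
    Measure.restrict_apply (measurable_lastHit hT hN), Measure.smul_apply,
    Measure.restrict_apply hN]
  have hsub : lastHit (velTo p t) T ⁻¹' N ∩ hitSet p T t ⊆ velTo p t '' (N ∩ Icc 0 t) := by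
    rintro v ⟨hvN, hv, hpos⟩
    exact ⟨_, ⟨hvN, hpos.le, lastHit_velTo_le ht hv⟩, velTo_lastHit_eq hp htT hv hpos⟩
  refine (measure_mono hsub).trans ?_
  have := (lipschitzWith_velTo hp t).hausdorffMeasure_image_le zero_le_one (N ∩ Icc 0 t)
  simpa [hausdorffMeasure_real] using this

lemma ae_hitSet_of_ae (hp : LipschitzWith L p) (ht : 0 ≤ t) (htT : t ≤ T) {q : ℝ → Prop}
    (h : ∀ᵐ s ∂volume.restrict (Icc 0 t), q s) :
    ∀ᵐ v ∂volume.restrict (hitSet p T t), q (lastHit (velTo p t) T v) := by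
  have h1 : (volume.restrict (hitSet p T t)).map (lastHit (velTo p t) T) ≪
      volume.restrict (Icc 0 t) :=
    (Measure.absolutelyContinuous_of_le (map_lastHit_le hp ht htT)).trans
      Measure.smul_absolutelyContinuous
  exact ae_of_ae_map (measurable_lastHit (ht.trans htT)).aemeasurable (h1.ae_le h)

lemma integrableOn_comp_lastHit (hp : LipschitzWith L p) (ht : 0 ≤ t) (htT : t ≤ T) {h : ℝ → ℝ}
    (hh : IntegrableOn h (Icc 0 t)) :
    IntegrableOn (fun v => h (lastHit (velTo p t) T v)) (hitSet p T t) := by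
  have h1 : Integrable h ((L : ENNReal) • volume.restrict (Icc 0 t)) :=
    hh.smul_measure ENNReal.coe_ne_top
  exact (h1.mono_measure (map_lastHit_le hp ht htT)).comp_measurable
    (measurable_lastHit (ht.trans htT))

lemma integral_comp_lastHit_le (hp : LipschitzWith L p) (ht : 0 ≤ t) (htT : t ≤ T) {h : ℝ → ℝ}
    (hh : IntegrableOn h (Icc 0 t)) (h0 : ∀ s, 0 ≤ h s) :
    ∫ v in hitSet p T t, h (lastHit (velTo p t) T v) ≤ L * ∫ s in Icc 0 t, h s := by
  have h1 : Integrable h ((L : ENNReal) • volume.restrict (Icc 0 t)) :=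
    hh.smul_measure ENNReal.coe_ne_top
  have h2 := h1.mono_measure (map_lastHit_le hp ht htT)
  rw [← integral_map (measurable_lastHit (ht.trans htT)).aemeasurable h2.aestronglyMeasurable]
  refine (integral_mono_measure (map_lastHit_le hp ht htT) (ae_of_all _ h0) h1).trans_eq ?_
  rw [integral_smul_measure]
  simp

end VelTo

/-! ### Monotone functions which agree up to a shift of the argument -/

/-- The difference lies below `χ₁ (v + D) - χ₁ (v - D)`, whose integral telescopes to the difference
of the integrals of `χ₁` over two intervals of length `2 * D` at the ends. Jumps of either function
are harmless. -/
lemma integral_abs_sub_le_of_shift {χ₁ χ₂ : ℝ → ℝ} {c d D a b : ℝ} (hm : Monotone χ₁)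
    (hm₂ : Monotone χ₂) (hc : ∀ v, c ≤ χ₁ v) (hd : ∀ v, χ₁ v ≤ d) (hD : 0 ≤ D)
    (h₁ : ∀ v, χ₁ v ≤ χ₂ (v + D)) (h₂ : ∀ v, χ₂ v ≤ χ₁ (v + D)) (hab : a ≤ b) :
    ∫ v in a..b, |χ₁ v - χ₂ v| ≤ 2 * D * (d - c) := by
  have hi : ∀ (x y e : ℝ), IntervalIntegrable (fun v => χ₁ (v + e)) volume x y := fun x y e =>
    (hm.comp (monotone_id.add_const e)).intervalIntegrable
  have hi' : ∀ (x y : ℝ), IntervalIntegrable χ₁ volume x y := fun x y => hm.intervalIntegrable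
  have key : ∀ v, |χ₁ v - χ₂ v| ≤ χ₁ (v + D) - χ₁ (v + -D) := by
    intro v
    have e1 := h₁ (v + -D)
    have e2 := h₂ v
    simp only [neg_add_cancel_right] at e1
    have := hm (show v ≤ v + D by linarith)
    have := hm (show v + -D ≤ v by linarith)
    rw [abs_le]; constructor <;> linarith
  refine (intervalIntegral.integral_mono_on hab ?_ ((hi a b D).sub (hi a b (-D)))
    fun v _ => key v).trans ?_
  · exact ((hi' a b).sub hm₂.intervalIntegrable).abs
  rw [intervalIntegral.integral_sub (hi a b D) (hi a b (-D)),
    intervalIntegral.integral_comp_add_right, intervalIntegral.integral_comp_add_right]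
  have e1 := intervalIntegral.integral_add_adjacent_intervals (hi' (a + -D) (a + D))
    (hi' (a + D) (b + D))
  have e2 := intervalIntegral.integral_add_adjacent_intervals (hi' (a + -D) (b + -D))
    (hi' (b + -D) (b + D))
  have u : ∫ x in b + -D..b + D, χ₁ x ≤ ∫ x in b + -D..b + D, d :=
    intervalIntegral.integral_mono_on (by linarith) (hi' _ _) (by simp) fun v _ => hd v
  have l : ∫ x in a + -D..a + D, c ≤ ∫ x in a + -D..a + D, χ₁ x :=
    intervalIntegral.integral_mono_on (by linarith) (by simp) (hi' _ _) fun v _ => hc v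
  simp only [intervalIntegral.integral_const, smul_eq_mul] at u l
  linarith

/-! ### Velocity moments of the precollisional density -/

/-- The weight `(x - v)₊ ^ k`. -/
noncomputable def wt (k : ℕ) (x v : ℝ) : ℝ := (max (x - v) 0) ^ k

section Weight

variable {k : ℕ} {x y v P : ℝ}

lemma continuous_wt (k : ℕ) (x : ℝ) : Continuous (wt k x) := by
  unfold wt; fun_prop

lemma wt_nonneg : 0 ≤ wt k x v := pow_nonneg (le_max_right _ _) _

lemma wt_of_le (hk : k ≠ 0) (h : x ≤ v) : wt k x v = 0 := by
  simp [wt, max_eq_right (sub_nonpos.2 h), hk]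

lemma wt_of_ge (h : v ≤ x) : wt k x v = (x - v) ^ k := by
  simp [wt, max_eq_left (sub_nonneg.2 h)]

/-- The summand 1 makes a single quadratic weight dominate both the first and the second power. -/
lemma wt_le (hk : k = 1 ∨ k = 2) (hx : |x| ≤ P) (hv : v ≤ P) : wt k x v ≤ (1 + P - v) ^ 2 := by
  have h1 := (abs_le.1 hx).2
  have h0 : 0 ≤ max (x - v) 0 := le_max_right _ _
  have h2 : max (x - v) 0 ≤ P - v := max_le (by linarith) (by linarith)
  rcases hk with rfl | rfl <;> unfold wt <;> nlinarith

lemma abs_wt_sub_le (hk : k = 1 ∨ k = 2) (hx : |x| ≤ P) (hy : |y| ≤ P) (hv : v ≤ P) :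
    |wt k x v - wt k y v| ≤ |x - y| * (2 * (1 + P - v)) := by
  have hm : |max (x - v) 0 - max (y - v) 0| ≤ |x - y| := by
    simpa using abs_max_sub_max_le_max (x - v) 0 (y - v) 0
  have hx0 : 0 ≤ max (x - v) 0 := le_max_right _ _
  have hy0 : 0 ≤ max (y - v) 0 := le_max_right _ _
  have hx1 : max (x - v) 0 ≤ P - v := max_le (by linarith [(abs_le.1 hx).2]) (by linarith)
  have hy1 : max (y - v) 0 ≤ P - v := max_le (by linarith [(abs_le.1 hy).2]) (by linarith)
  have h0 := abs_nonneg (x - y)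
  rcases hk with rfl | rfl <;> unfold wt
  · simp only [pow_one]
    nlinarith
  · rw [sq_sub_sq, abs_mul, mul_comm]
    refine mul_le_mul hm ?_ (abs_nonneg _) h0
    rw [abs_of_nonneg (by positivity)]
    linarith

end Weight

/-- The gas density after a collision at time `τ` if `τ > 0`, and the initial density otherwise. -/
noncomputable def gasTrace (φ p J : ℝ → ℝ) (τ v : ℝ) : ℝ :=
  if 0 < τ then 2 * Real.exp (-(v - p τ) ^ 2) * J τ else φ v

/-- The `k`-th moment of the density arriving at the disk from the right at time `t`, if the mass
flux into the disk at earlier times was `J`. -/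
noncomputable def moment (φ p J : ℝ → ℝ) (T : ℝ) (k : ℕ) (t : ℝ) : ℝ :=
  ∫ v in Iio (p t), (p t - v) ^ k * gasTrace φ p J (lastHit (velTo p t) T v) v

/-- The bounded initial densities with sufficiently many moments. -/
structure IsInitialDensity (φ : ℝ → ℝ) (B P : ℝ) : Prop where
  measurable : Measurable φ
  abs_le : ∀ v, |φ v| ≤ B
  integrableOn : IntegrableOn (fun v => (1 + P - v) ^ 2 * φ v) (Iio (-P))

/-- The density in `moment`, written with indicator functions. -/
noncomputable def arrivingDensity (φ p J : ℝ → ℝ) (T t v : ℝ) : ℝ :=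
  (hitSet p T t).indicator (fun v => 2 * Real.exp (-(v - p (lastHit (velTo p t) T v)) ^ 2) *
    J (lastHit (velTo p t) T v)) v + (hitSet p T t)ᶜ.indicator φ v

section Moment

variable {φ p J : ℝ → ℝ} {L : NNReal} {B P T t : ℝ} {k : ℕ}

lemma gasTrace_eq_arrivingDensity {v : ℝ} (hv : v < p t) :
    gasTrace φ p J (lastHit (velTo p t) T v) v = arrivingDensity φ p J T t v := by
  unfold gasTrace arrivingDensity
  by_cases h : 0 < lastHit (velTo p t) T v
  · have hm : v ∈ hitSet p T t := ⟨hv, h⟩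
    simp [h, hm]
  · have hm : v ∉ hitSet p T t := fun hm => h hm.2
    simp [h, hm]

/-- A particle slower than `-P` cannot have been overtaken from a previous collision, because mean
disk velocities are at least `-P`. -/
lemma hitSet_subset (hp : Continuous p) (hT : 0 ≤ T) (hP : ∀ s, |p s| ≤ P) :
    hitSet p T t ⊆ Icc (-P) P := by
  rintro v ⟨hv, hpos⟩
  refine ⟨?_, hv.le.trans (abs_le.1 (hP t)).2⟩
  by_contra! h
  refine hpos.ne' (lastHit_eq_zero hT fun τ _ => h.trans_le ?_)
  exact (abs_le.1 (abs_velTo_le hp hP t τ)).1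

lemma exp_neg_sq_le_one (x : ℝ) : Real.exp (-x ^ 2) ≤ 1 :=
  Real.exp_le_one_iff.2 (by nlinarith [sq_nonneg x])

lemma integrableOn_collided (hp : LipschitzWith L p) (ht : 0 ≤ t) (htT : t ≤ T)
    (hJ : IntegrableOn J (Icc 0 T)) :
    IntegrableOn (fun v => 2 * Real.exp (-(v - p (lastHit (velTo p t) T v)) ^ 2) *
      J (lastHit (velTo p t) T v)) (hitSet p T t) := by
  have h1 := integrableOn_comp_lastHit hp ht htT (hJ.mono_set (Icc_subset_Icc_right htT))
  refine Integrable.bdd_mul (c := 2) h1 ?_ (ae_of_all _ fun v => ?_)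
  · have h2 : Measurable fun v => p (lastHit (velTo p t) T v) :=
      hp.continuous.measurable.comp (measurable_lastHit (ht.trans htT))
    exact (((((measurable_id.sub h2).pow_const 2).neg).exp).const_mul 2).aestronglyMeasurable
  · rw [Real.norm_eq_abs, abs_of_pos (by positivity)]
    linarith [exp_neg_sq_le_one (v - p (lastHit (velTo p t) T v))]

lemma integrableOn_wt_mul_arrivingDensity (hφ : IsInitialDensity φ B P) (hp : LipschitzWith L p)
    (hP : ∀ s, |p s| ≤ P) (hk : k = 1 ∨ k = 2) (ht : 0 ≤ t) (htT : t ≤ T)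
    (hJ : IntegrableOn J (Icc 0 T)) :
    IntegrableOn (fun v => wt k (p t) v * arrivingDensity φ p J T t v) (Icc (-P) P) := by
  have h1 : IntegrableOn (arrivingDensity φ p J T t) (Icc (-P) P) := by
    refine Integrable.add ?_ ?_
    · exact ((integrableOn_collided hp ht htT hJ).integrable_indicator
        (measurableSet_hitSet (ht.trans htT))).integrableOn
    · refine Integrable.indicator ?_ (measurableSet_hitSet (ht.trans htT)).compl
      refine Measure.integrableOn_of_bounded (M := B) (by simp)
        hφ.measurable.aestronglyMeasurable (ae_of_all _ fun v => hφ.abs_le v)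
  refine Integrable.bdd_mul (c := (1 + P + P) ^ 2) h1 (continuous_wt _ _).aestronglyMeasurable ?_
  filter_upwards [ae_restrict_mem measurableSet_Icc] with v hv
  rw [Real.norm_eq_abs, abs_of_nonneg wt_nonneg]
  refine (wt_le hk (hP t) hv.2).trans ?_
  have := hv.1; have := hv.2
  gcongr <;> linarith

lemma integrableOn_wt_mul (hφ : IsInitialDensity φ B P) {x : ℝ} (hx : |x| ≤ P)
    (hk : k = 1 ∨ k = 2) : IntegrableOn (fun v => wt k x v * φ v) (Iio (-P)) := by
  have hP : 0 ≤ P := (abs_nonneg _).trans hx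
  refine Integrable.mono hφ.integrableOn
    ((continuous_wt k x).measurable.mul hφ.measurable).aestronglyMeasurable ?_
  filter_upwards [ae_restrict_mem measurableSet_Iio] with v hv
  rw [norm_mul, norm_mul, Real.norm_eq_abs, Real.norm_eq_abs ((1 + P - v) ^ 2),
    abs_of_nonneg wt_nonneg, abs_of_nonneg (sq_nonneg (1 + P - v))]
  have : v < -P := hv
  exact mul_le_mul_of_nonneg_right (wt_le hk hx (by linarith)) (norm_nonneg _)

/-- The truncated weight makes the domain of integration independent of the disk velocity. Below
`-P` only uncollided gas arrives, and the unbounded tail involves only `φ`. -/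
lemma moment_eq (hφ : IsInitialDensity φ B P) (hp : LipschitzWith L p)
    (hP : ∀ s, |p s| ≤ P) (hk : k = 1 ∨ k = 2) (ht : 0 ≤ t) (htT : t ≤ T)
    (hJ : IntegrableOn J (Icc 0 T)) :
    moment φ p J T k t = (∫ v in Iio (-P), wt k (p t) v * φ v) +
      ∫ v in Icc (-P) P, wt k (p t) v * arrivingDensity φ p J T t v := by
  have hP0 : 0 ≤ P := (abs_nonneg _).trans (hP 0)
  have hk0 : k ≠ 0 := by rcases hk with rfl | rfl <;> simp
  have hfar : EqOn (fun v => wt k (p t) v * φ v)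
      (fun v => wt k (p t) v * arrivingDensity φ p J T t v) (Iio (-P)) := by
    intro v hv
    have : v ∉ hitSet p T t := fun h =>
      absurd (hitSet_subset hp.continuous (ht.trans htT) hP h).1 (not_le.2 hv)
    simp [arrivingDensity, this]
  rw [setIntegral_congr_fun measurableSet_Iio hfar, ← setIntegral_union _ measurableSet_Icc
    ((integrableOn_congr_fun hfar measurableSet_Iio).1 (integrableOn_wt_mul hφ (hP t) hk))
    (integrableOn_wt_mul_arrivingDensity hφ hp hP hk ht htT hJ)]
  · have e1 : moment φ p J T k t =
        ∫ v in Iio (p t), wt k (p t) v * arrivingDensity φ p J T t v := by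
      refine setIntegral_congr_fun measurableSet_Iio fun v hv => ?_
      rw [gasTrace_eq_arrivingDensity hv, wt_of_ge (le_of_lt hv)]
    rw [e1, setIntegral_eq_integral_of_forall_compl_eq_zero,
      setIntegral_eq_integral_of_forall_compl_eq_zero]
    · intro v hv
      have : P ≤ v := by
        by_contra! h
        by_cases h' : v < -P
        · exact hv (Or.inl h')
        · exact hv (Or.inr ⟨not_lt.1 h', h.le⟩)
      rw [wt_of_le hk0 ((abs_le.1 (hP t)).2.trans this), zero_mul]
    · intro v hv
      rw [wt_of_le hk0 (not_lt.1 hv), zero_mul]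
  · refine disjoint_left.2 fun v hv hv' => ?_
    exact absurd hv'.1 (not_le.2 hv)

/-- Equality almost everywhere of the fluxes suffices for equality of the moments. -/
lemma moment_congr {J' : ℝ → ℝ} (hp : LipschitzWith L p) (ht : 0 ≤ t) (htT : t ≤ T)
    (h : ∀ᵐ s ∂volume.restrict (Icc 0 T), J s = J' s) :
    moment φ p J T k t = moment φ p J' T k t := by
  have h1 := ae_hitSet_of_ae (T := T) hp ht htT
    (ae_restrict_of_ae_restrict_of_subset (Icc_subset_Icc_right htT) h)
  rw [ae_restrict_iff' (measurableSet_hitSet (ht.trans htT))] at h1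
  refine setIntegral_congr_ae measurableSet_Iio ?_
  filter_upwards [h1] with v hv hvp
  unfold gasTrace
  split_ifs with h0
  · rw [hv ⟨hvp, h0⟩]
  · rfl

/-- The change of variables bounds the collided part by the L¹ norm of `J`, so one application of
the integral equation improves an integrable flux to a bounded one. -/
lemma exists_abs_moment_le (hφ : IsInitialDensity φ B P) (hp : LipschitzWith L p)
    (hP : ∀ s, |p s| ≤ P) (hk : k = 1 ∨ k = 2) (hJ : IntegrableOn J (Icc 0 T)) :
    ∃ Q, ∀ t ∈ Icc 0 T, |moment φ p J T k t| ≤ Q := by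
  have hP0 : 0 ≤ P := (abs_nonneg _).trans (hP 0)
  have hB : 0 ≤ B := (abs_nonneg _).trans (hφ.abs_le 0)
  refine ⟨(∫ v in Iio (-P), |(1 + P - v) ^ 2 * φ v|) + ((∫ v in Icc (-P) P,
    (1 + P + P) ^ 2 * B) + (1 + P + P) ^ 2 * 2 * (L * ∫ s in Icc 0 T, |J s|)), ?_⟩
  rintro t ⟨ht, htT⟩
  rw [moment_eq hφ hp hP hk ht htT hJ]
  refine (abs_add_le _ _).trans (add_le_add ?_ ?_)
  · rw [← Real.norm_eq_abs]
    refine norm_integral_le_of_norm_le hφ.integrableOn.abs ?_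
    filter_upwards [ae_restrict_mem measurableSet_Iio] with v hv
    have : v < -P := hv
    rw [norm_mul, abs_mul, Real.norm_eq_abs, Real.norm_eq_abs, abs_of_nonneg wt_nonneg,
      abs_of_nonneg (sq_nonneg (1 + P - v))]
    exact mul_le_mul_of_nonneg_right (wt_le hk (hP t) (by linarith)) (abs_nonneg _)
  · have hJt : IntegrableOn (fun s => |J s|) (Icc 0 t) :=
      (hJ.mono_set (Icc_subset_Icc_right htT)).abs
    have i1 := integrableOn_comp_lastHit hp ht htT hJt
    have hS : MeasurableSet (hitSet p T t) := measurableSet_hitSet (ht.trans htT)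
    have i2 : IntegrableOn (fun v => (1 + P + P) ^ 2 * 2 *
        (hitSet p T t).indicator (fun v => |J (lastHit (velTo p t) T v)|) v) (Icc (-P) P) :=
      (((integrable_indicator_iff hS).2 i1).const_mul _).integrableOn
    have i3 : IntegrableOn (fun _ => (1 + P + P) ^ 2 * B) (Icc (-P) P) :=
      integrableOn_const (by simp)
    have i4 : IntegrableOn (fun v => (1 + P + P) ^ 2 * B + (1 + P + P) ^ 2 * 2 *
        (hitSet p T t).indicator (fun v => |J (lastHit (velTo p t) T v)|) v) (Icc (-P) P) :=
      i3.add i2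
    rw [← Real.norm_eq_abs]
    refine (norm_integral_le_of_norm_le i4 ?_).trans ?_
    · filter_upwards [ae_restrict_mem measurableSet_Icc] with v hv
      have hw : wt k (p t) v ≤ (1 + P + P) ^ 2 := by
        refine (wt_le hk (hP t) hv.2).trans ?_
        have := hv.1; have := hv.2
        gcongr <;> linarith
      rw [norm_mul, Real.norm_eq_abs, Real.norm_eq_abs, abs_of_nonneg wt_nonneg]
      have hd : |arrivingDensity φ p J T t v| ≤
          B + 2 * (hitSet p T t).indicator (fun v => |J (lastHit (velTo p t) T v)|) v := by
        by_cases hm : v ∈ hitSet p T t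
        · simp only [arrivingDensity, hm, indicator_of_mem, mem_compl_iff, not_true_eq_false,
            not_false_eq_true, indicator_of_notMem, add_zero, abs_mul]
          rw [abs_of_nonneg (by positivity : (0 : ℝ) ≤ 2), abs_of_pos (Real.exp_pos _)]
          have := exp_neg_sq_le_one (v - p (lastHit (velTo p t) T v))
          nlinarith [abs_nonneg (J (lastHit (velTo p t) T v))]
        · simp [arrivingDensity, hm, hφ.abs_le v]
      calc wt k (p t) v * |arrivingDensity φ p J T t v|
          ≤ (1 + P + P) ^ 2 * (B + 2 * (hitSet p T t).indicator
              (fun v => |J (lastHit (velTo p t) T v)|) v) :=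
            mul_le_mul hw hd (abs_nonneg _) (by positivity)
        _ = _ := by ring
    · rw [integral_add i3 i2, integral_const_mul ((1 + P + P) ^ 2 * 2)]
      gcongr
      refine (setIntegral_le_integral ((integrable_indicator_iff hS).2 i1) (ae_of_all _ fun v =>
        indicator_nonneg (fun _ _ => abs_nonneg _) _)).trans ?_
      rw [integral_indicator hS]
      refine (integral_comp_lastHit_le hp ht htT hJt fun s => abs_nonneg _).trans ?_
      gcongr
      · exact ae_of_all _ fun s => abs_nonneg _
      · exact hJ.abs

end Moment

/-- The derivative is bounded by 1, since `2 * |z| ≤ 1 + z ^ 2 ≤ exp (z ^ 2)`. -/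
lemma abs_exp_neg_sq_sub_le (x y : ℝ) : |Real.exp (-x ^ 2) - Real.exp (-y ^ 2)| ≤ |x - y| := by
  have hd : ∀ z : ℝ, HasDerivAt (fun z : ℝ => Real.exp (-z ^ 2))
      (Real.exp (-z ^ 2) * (-(2 * z))) z := fun z => by
    simpa using ((hasDerivAt_pow 2 z).neg).exp
  have hb : ∀ z : ℝ, ‖Real.exp (-z ^ 2) * (-(2 * z))‖ ≤ 1 := fun z => by
    rw [norm_mul, norm_neg, Real.norm_eq_abs, Real.norm_eq_abs, abs_of_pos (Real.exp_pos _),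
      Real.exp_neg, inv_mul_le_iff₀ (Real.exp_pos _), mul_one]
    refine le_trans ?_ (Real.add_one_le_exp (z ^ 2))
    rw [abs_le]
    constructor <;> nlinarith [sq_nonneg (z - 1), sq_nonneg (z + 1)]
  have := convex_univ.norm_image_sub_le_of_norm_hasDerivWithin_le
    (fun z _ => (hd z).hasDerivWithinAt) (fun z _ => hb z) (mem_univ y) (mem_univ x)
  simpa using this

/-- A Lipschitz disk velocity `p` together with a bounded mass flux `J` into the disk. -/
structure IsFlow (L : NNReal) (P Q T : ℝ) (p J : ℝ → ℝ) : Prop where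
  lipschitz : LipschitzWith L p
  abs_le : ∀ s, |p s| ≤ P
  integrableOn : IntegrableOn J (Icc 0 T)
  abs_flux_le : ∀ s ∈ Icc 0 T, |J s| ≤ Q

/-- The last time before `t` at which the trajectory of velocity `v` arriving at time `t` left
the disk. -/
noncomputable abbrev lastLeave (p : ℝ → ℝ) (T t v : ℝ) : ℝ := lastHit (velTo p t) T v

/-! ### Comparison of the moments of two flows -/

section Difference

variable {φ p p₁ p₂ J J₁ J₂ : ℝ → ℝ} {L : NNReal} {B P Q T t t₁ t₂ Δ v : ℝ} {k : ℕ}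

lemma IsFlow.abs_arrivingDensity_le (h : IsFlow L P Q T p J) (hφ : IsInitialDensity φ B P)
    (hT : 0 ≤ T) (v : ℝ) : |arrivingDensity φ p J T t v| ≤ B + 2 * Q := by
  have hB : 0 ≤ B := (abs_nonneg _).trans (hφ.abs_le 0)
  have hJ := h.abs_flux_le (lastLeave p T t v) ⟨lastHit_nonneg hT, lastHit_le hT⟩
  have hQ : 0 ≤ Q := (abs_nonneg _).trans hJ
  by_cases hm : v ∈ hitSet p T t
  · simp only [arrivingDensity, hm, indicator_of_mem, mem_compl_iff, not_true_eq_false,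
      not_false_eq_true, indicator_of_notMem, add_zero, abs_mul]
    rw [abs_of_nonneg (by positivity : (0 : ℝ) ≤ 2), abs_of_pos (Real.exp_pos _)]
    have := exp_neg_sq_le_one (v - p (lastHit (velTo p t) T v))
    nlinarith [abs_nonneg (J (lastHit (velTo p t) T v))]
  · simp only [arrivingDensity, hm, not_false_eq_true, indicator_of_notMem, mem_compl_iff,
      indicator_of_mem, zero_add]
    linarith [hφ.abs_le v]

/-- `1` if the trajectory had an earlier collision, and `0` otherwise. -/
noncomputable def hasHit (p : ℝ → ℝ) (T t v : ℝ) : ℝ := if 0 < lastLeave p T t v then 1 else 0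

lemma monotone_hasHit (hT : 0 ≤ T) : Monotone (hasHit p T t) := by
  intro v w hvw
  have := monotone_lastHit (U := velTo p t) hT hvw
  unfold hasHit
  split_ifs with h1 h2
  · exact le_rfl
  · exact absurd (h1.trans_le this) h2
  · exact zero_le_one
  · exact le_rfl

lemma hasHit_le_shift (hT : 0 ≤ T) (hU : ∀ τ ∈ Icc 0 T, |velTo p₁ t₁ τ - velTo p₂ t₂ τ| ≤ Δ)
    (v : ℝ) : hasHit p₂ T t₂ v ≤ hasHit p₁ T t₁ (v + Δ) := by
  have := lastHit_le_shift hT hU v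
  unfold hasHit
  split_ifs with h1 h2
  · exact le_rfl
  · exact absurd (h1.trans_le this) h2
  · exact zero_le_one
  · exact le_rfl

/-- The disk velocities are compared through `p₁ τ₂`, so their closeness is needed only at `τ₂`, and
the time difference costs only the Lipschitz constant. -/
lemma abs_collided_sub_le (h₁ : IsFlow L P Q T p₁ J₁) (h₂ : IsFlow L P Q T p₂ J₂) {τ₁ τ₂ : ℝ}
    (hτ₂ : τ₂ ∈ Icc 0 T) (hp : |p₁ τ₂ - p₂ τ₂| ≤ Δ) (v : ℝ) :
    |2 * Real.exp (-(v - p₁ τ₁) ^ 2) * J₁ τ₁ - 2 * Real.exp (-(v - p₂ τ₂) ^ 2) * J₂ τ₂| ≤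
      2 * |J₁ τ₁ - J₂ τ₂| + 2 * Q * (L * |τ₁ - τ₂| + Δ) := by
  have e : 2 * Real.exp (-(v - p₁ τ₁) ^ 2) * J₁ τ₁ - 2 * Real.exp (-(v - p₂ τ₂) ^ 2) * J₂ τ₂ =
      2 * (Real.exp (-(v - p₁ τ₁) ^ 2) * (J₁ τ₁ - J₂ τ₂)) +
      2 * (J₂ τ₂ * (Real.exp (-(v - p₁ τ₁) ^ 2) - Real.exp (-(v - p₂ τ₂) ^ 2))) := by ring
  rw [e]
  refine (abs_add_le _ _).trans ?_
  simp only [abs_mul, abs_two, abs_of_pos (Real.exp_pos _)]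
  have hE := abs_exp_neg_sq_sub_le (v - p₁ τ₁) (v - p₂ τ₂)
  have hpd : |v - p₁ τ₁ - (v - p₂ τ₂)| ≤ L * |τ₁ - τ₂| + Δ := by
    have hl := h₁.lipschitz.dist_le_mul τ₁ τ₂
    rw [Real.dist_eq, Real.dist_eq] at hl
    have e2 : v - p₁ τ₁ - (v - p₂ τ₂) = -(p₁ τ₁ - p₁ τ₂) - (p₁ τ₂ - p₂ τ₂) := by ring
    rw [e2]
    refine (abs_sub _ _).trans ?_
    rw [abs_neg]
    linarith
  have hJ := h₂.abs_flux_le τ₂ hτ₂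
  have h3 : |J₂ τ₂| * |Real.exp (-(v - p₁ τ₁) ^ 2) - Real.exp (-(v - p₂ τ₂) ^ 2)| ≤
      Q * (L * |τ₁ - τ₂| + Δ) :=
    mul_le_mul hJ (hE.trans hpd) (abs_nonneg _) ((abs_nonneg _).trans hJ)
  have h4 : Real.exp (-(v - p₁ τ₁) ^ 2) * |J₁ τ₁ - J₂ τ₂| ≤ |J₁ τ₁ - J₂ τ₂| :=
    mul_le_of_le_one_left (abs_nonneg _) (exp_neg_sq_le_one _)
  linarith

/-- If a weight vanishes, the difference of the weights suffices. Otherwise both trajectories have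
collided, or neither has, or just one has; the last case has no small pointwise bound and is charged
to the `hasHit` term, which is small only after integration. -/
lemma abs_wt_mul_arrivingDensity_sub_le (hφ : IsInitialDensity φ B P)
    (h₁ : IsFlow L P Q T p₁ J₁) (h₂ : IsFlow L P Q T p₂ J₂) (hk : k = 1 ∨ k = 2)
    (ht₂ : t₂ ∈ Icc 0 T) (hpt : |p₁ t₁ - p₂ t₂| ≤ Δ)
    (hp : ∀ s ∈ Icc 0 t₂, |p₁ s - p₂ s| ≤ Δ) (hv : v ∈ Icc (-P) P) :
    |wt k (p₁ t₁) v * arrivingDensity φ p₁ J₁ T t₁ v -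
        wt k (p₂ t₂) v * arrivingDensity φ p₂ J₂ T t₂ v| ≤
      (2 * (1 + P + P) * (B + 2 * Q) + (1 + P + P) ^ 2 * (2 * Q)) * Δ +
      (1 + P + P) ^ 2 * (2 * (B + 2 * Q)) * |hasHit p₁ T t₁ v - hasHit p₂ T t₂ v| +
      (1 + P + P) ^ 2 * (2 * Q * L) * |lastLeave p₁ T t₁ v - lastLeave p₂ T t₂ v| +
      (1 + P + P) ^ 2 * 2 * (hitSet p₁ T t₁ ∩ hitSet p₂ T t₂).indicator
        (fun v => |J₁ (lastLeave p₁ T t₁ v) - J₂ (lastLeave p₂ T t₂ v)|) v := by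
  have hT : 0 ≤ T := ht₂.1.trans ht₂.2
  have hP0 : 0 ≤ P := (abs_nonneg _).trans (h₁.abs_le 0)
  have hB : 0 ≤ B := (abs_nonneg _).trans (hφ.abs_le 0)
  have hQ : 0 ≤ Q := (abs_nonneg _).trans (h₁.abs_flux_le 0 ⟨le_rfl, hT⟩)
  have hΔ : 0 ≤ Δ := (abs_nonneg _).trans hpt
  have hk0 : k ≠ 0 := by rcases hk with rfl | rfl <;> simp
  set τ₁ := lastLeave p₁ T t₁ v with hτ₁
  set τ₂ := lastLeave p₂ T t₂ v with hτ₂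
  set d₁ := arrivingDensity φ p₁ J₁ T t₁ v with hd₁
  set d₂ := arrivingDensity φ p₂ J₂ T t₂ v with hd₂
  set w₁ := wt k (p₁ t₁) v with hw₁
  set w₂ := wt k (p₂ t₂) v with hw₂
  set M := B + 2 * Q with hM
  set W := (1 + P + P) ^ 2 with hW
  have hM0 : 0 ≤ M := by positivity
  have hd₁M : |d₁| ≤ M := h₁.abs_arrivingDensity_le hφ hT v
  have hd₂M : |d₂| ≤ M := h₂.abs_arrivingDensity_le hφ hT v
  have hwd : |w₁ - w₂| ≤ 2 * (1 + P + P) * Δ := by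
    refine (abs_wt_sub_le hk (h₁.abs_le t₁) (h₂.abs_le t₂) hv.2).trans ?_
    rw [mul_comm]
    have := hv.1; have := hv.2
    gcongr <;> linarith
  have hwdM : |w₁ - w₂| * M ≤ 2 * (1 + P + P) * M * Δ := by
    calc |w₁ - w₂| * M ≤ 2 * (1 + P + P) * Δ * M := by gcongr
      _ = _ := by ring
  have hw₂W : w₂ ≤ W := by
    refine (wt_le hk (h₂.abs_le t₂) hv.2).trans ?_
    have := hv.1; have := hv.2
    rw [hW]
    gcongr <;> linarith
  have hw₂0 : 0 ≤ w₂ := wt_nonneg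
  have hW0 : 0 ≤ W := by positivity
  have n1 : 0 ≤ W * (2 * M) * |hasHit p₁ T t₁ v - hasHit p₂ T t₂ v| := by positivity
  have n2 : 0 ≤ W * (2 * Q * L) * |τ₁ - τ₂| := by positivity
  have n3 : 0 ≤ W * 2 * (hitSet p₁ T t₁ ∩ hitSet p₂ T t₂).indicator
        (fun v => |J₁ (lastLeave p₁ T t₁ v) - J₂ (lastLeave p₂ T t₂ v)|) v :=
    mul_nonneg (by positivity) (indicator_nonneg (fun _ _ => abs_nonneg _) _)
  have n4 : 0 ≤ W * (2 * Q) * Δ := by positivity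
  rcases le_or_gt (p₁ t₁) v with hv₁ | hv₁
  · have hw : w₁ = 0 := wt_of_le hk0 hv₁
    have : |w₁ * d₁ - w₂ * d₂| ≤ |w₁ - w₂| * M := by
      rw [hw, zero_mul, zero_sub, zero_sub, abs_neg, abs_neg, abs_mul]
      gcongr
    linarith
  rcases le_or_gt (p₂ t₂) v with hv₂ | hv₂
  · have hw : w₂ = 0 := wt_of_le hk0 hv₂
    have : |w₁ * d₁ - w₂ * d₂| ≤ |w₁ - w₂| * M := by
      rw [hw, zero_mul, sub_zero, sub_zero, abs_mul]
      gcongr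
    linarith
  have hsplit : |w₁ * d₁ - w₂ * d₂| ≤ |w₁ - w₂| * M + W * |d₁ - d₂| := by
    have e : w₁ * d₁ - w₂ * d₂ = (w₁ - w₂) * d₁ + w₂ * (d₁ - d₂) := by ring
    rw [e]
    refine (abs_add_le _ _).trans ?_
    rw [abs_mul, abs_mul, abs_of_nonneg hw₂0]
    gcongr
  have hone : |hasHit p₁ T t₁ v - hasHit p₂ T t₂ v| = 1 → W * |d₁ - d₂| ≤
      W * (2 * M) * |hasHit p₁ T t₁ v - hasHit p₂ T t₂ v| := by
    intro h
    rw [h, mul_one]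
    refine mul_le_mul_of_nonneg_left ?_ hW0
    exact (abs_sub _ _).trans (by linarith)
  by_cases hz₁ : 0 < τ₁ <;> by_cases hz₂ : 0 < τ₂
  · have m₁ : v ∈ hitSet p₁ T t₁ := ⟨hv₁, hz₁⟩
    have m₂ : v ∈ hitSet p₂ T t₂ := ⟨hv₂, hz₂⟩
    have hd : |d₁ - d₂| ≤ 2 * |J₁ τ₁ - J₂ τ₂| + 2 * Q * (L * |τ₁ - τ₂| + Δ) := by
      have := abs_collided_sub_le h₁ h₂ (τ₁ := τ₁) (τ₂ := τ₂)
        ⟨lastHit_nonneg hT, lastHit_le hT⟩ (hp τ₂ ⟨hz₂.le, lastHit_velTo_le ht₂.1 hv₂⟩) v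
      simpa only [hd₁, hd₂, arrivingDensity, m₁, m₂, indicator_of_mem, mem_compl_iff,
        not_true_eq_false, not_false_eq_true, indicator_of_notMem, add_zero] using this
    have hi : (hitSet p₁ T t₁ ∩ hitSet p₂ T t₂).indicator
        (fun v => |J₁ (lastLeave p₁ T t₁ v) - J₂ (lastLeave p₂ T t₂ v)|) v =
        |J₁ τ₁ - J₂ τ₂| := indicator_of_mem (mem_inter m₁ m₂) _
    rw [hi]
    have := mul_le_mul_of_nonneg_left hd hW0
    linarith
  · have : |hasHit p₁ T t₁ v - hasHit p₂ T t₂ v| = 1 := by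
      simp only [hasHit]; rw [if_pos hz₁, if_neg hz₂]; simp
    linarith [hone this]
  · have : |hasHit p₁ T t₁ v - hasHit p₂ T t₂ v| = 1 := by
      simp only [hasHit]; rw [if_neg hz₁, if_pos hz₂]; simp
    linarith [hone this]
  · have m₁ : v ∉ hitSet p₁ T t₁ := fun h => hz₁ h.2
    have m₂ : v ∉ hitSet p₂ T t₂ := fun h => hz₂ h.2
    have : d₁ - d₂ = 0 := by simp [hd₁, hd₂, arrivingDensity, m₁, m₂]
    rw [this, abs_zero, mul_zero, add_zero] at hsplit
    linarith

lemma integrableOn_flux_diff (h₁ : IsFlow L P Q T p₁ J₁) (h₂ : IsFlow L P Q T p₂ J₂)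
    (ht₁ : t₁ ∈ Icc 0 T) (ht₂ : t₂ ∈ Icc 0 T) :
    IntegrableOn (fun v => |J₁ (lastLeave p₁ T t₁ v) - J₂ (lastLeave p₂ T t₂ v)|)
      (hitSet p₁ T t₁ ∩ hitSet p₂ T t₂) := by
  have i₁ := integrableOn_comp_lastHit h₁.lipschitz ht₁.1 ht₁.2
    (h₁.integrableOn.mono_set (Icc_subset_Icc_right ht₁.2))
  have i₂ := integrableOn_comp_lastHit h₂.lipschitz ht₂.1 ht₂.2
    (h₂.integrableOn.mono_set (Icc_subset_Icc_right ht₂.2))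
  exact ((i₁.mono_set inter_subset_left).sub (i₂.mono_set inter_subset_right)).abs

/-- The moments depend on the time and on the disk trajectory in a Lipschitz continuous way, up to
the difference of the fluxes at the times of the previous collision. -/
lemma exists_abs_moment_sub_le (hφ : IsInitialDensity φ B P) (hP : 0 ≤ P) (hT : 0 ≤ T)
    (hQ : 0 ≤ Q) (L : NNReal) :
    ∃ C, 0 ≤ C ∧ ∀ (k : ℕ) (p₁ p₂ J₁ J₂ : ℝ → ℝ) (t₁ t₂ Δ : ℝ), (k = 1 ∨ k = 2) →
      IsFlow L P Q T p₁ J₁ → IsFlow L P Q T p₂ J₂ → t₁ ∈ Icc 0 T → t₂ ∈ Icc 0 T →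
      (∀ τ ∈ Icc 0 T, |velTo p₁ t₁ τ - velTo p₂ t₂ τ| ≤ Δ) →
      (∀ s ∈ Icc 0 t₂, |p₁ s - p₂ s| ≤ Δ) →
      |moment φ p₁ J₁ T k t₁ - moment φ p₂ J₂ T k t₂| ≤ C * Δ +
        C * ∫ v in hitSet p₁ T t₁ ∩ hitSet p₂ T t₂,
          |J₁ (lastLeave p₁ T t₁ v) - J₂ (lastLeave p₂ T t₂ v)| := by
  have hB : 0 ≤ B := (abs_nonneg _).trans (hφ.abs_le 0)
  set K := ∫ v in Iio (-P), 2 * |(1 + P - v) ^ 2 * φ v| with hK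
  have hK0 : 0 ≤ K := integral_nonneg fun v => by positivity
  set c₀ := 2 * (1 + P + P) * (B + 2 * Q) + (1 + P + P) ^ 2 * (2 * Q) with hc₀
  set c₁ := (1 + P + P) ^ 2 * (2 * (B + 2 * Q)) with hc₁
  set c₂ := (1 + P + P) ^ 2 * (2 * Q * L) with hc₂
  set c₃ := (1 + P + P) ^ 2 * 2 with hc₃
  have hc₀0 : 0 ≤ c₀ := by positivity
  have hc₁0 : 0 ≤ c₁ := by positivity
  have hc₂0 : 0 ≤ c₂ := by positivity
  have hc₃0 : 0 ≤ c₃ := by positivity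
  refine ⟨K + 2 * P * c₀ + 2 * c₁ + 2 * T * c₂ + c₃, by positivity, ?_⟩
  intro k p₁ p₂ J₁ J₂ t₁ t₂ Δ hk h₁ h₂ ht₁ ht₂ hU hp
  have hpt : |p₁ t₁ - p₂ t₂| ≤ Δ := by
    -- At `τ = T`, which is past both times, `velTo` is continued by the disk velocity itself.
    have := hU T ⟨hT, le_rfl⟩
    rwa [velTo_of_le p₁ ht₁.2, velTo_of_le p₂ ht₂.2] at this
  have hΔ : 0 ≤ Δ := (abs_nonneg _).trans hpt
  have hU' : ∀ τ ∈ Icc 0 T, |velTo p₂ t₂ τ - velTo p₁ t₁ τ| ≤ Δ := fun τ hτ => by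
    rw [abs_sub_comm]; exact hU τ hτ
  set I := ∫ v in hitSet p₁ T t₁ ∩ hitSet p₂ T t₂,
          |J₁ (lastLeave p₁ T t₁ v) - J₂ (lastLeave p₂ T t₂ v)| with hI
  have hI0 : 0 ≤ I := integral_nonneg fun v => abs_nonneg _
  rw [moment_eq hφ h₁.lipschitz h₁.abs_le hk ht₁.1 ht₁.2 h₁.integrableOn,
    moment_eq hφ h₂.lipschitz h₂.abs_le hk ht₂.1 ht₂.2 h₂.integrableOn]
  have far : |(∫ v in Iio (-P), wt k (p₁ t₁) v * φ v) - ∫ v in Iio (-P), wt k (p₂ t₂) v * φ v| ≤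
      K * Δ := by
    rw [← integral_sub (integrableOn_wt_mul hφ (h₁.abs_le _) hk)
      (integrableOn_wt_mul hφ (h₂.abs_le _) hk), hK, ← integral_mul_const, ← Real.norm_eq_abs]
    refine norm_integral_le_of_norm_le ((hφ.integrableOn.abs.const_mul 2).mul_const _) ?_
    filter_upwards [ae_restrict_mem measurableSet_Iio] with v hv
    have hv' : v < -P := hv
    rw [← sub_mul, norm_mul, abs_mul, Real.norm_eq_abs, Real.norm_eq_abs,
      abs_of_nonneg (sq_nonneg (1 + P - v))]
    have h5 := abs_wt_sub_le (v := v) hk (h₁.abs_le t₁) (h₂.abs_le t₂) (by linarith)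
    have h6 : |p₁ t₁ - p₂ t₂| * (2 * (1 + P - v)) ≤ Δ * (2 * (1 + P - v) ^ 2) := by
      refine mul_le_mul hpt ?_ (by linarith) hΔ
      nlinarith
    calc _ ≤ Δ * (2 * (1 + P - v) ^ 2) * |φ v| :=
          mul_le_mul_of_nonneg_right (h5.trans h6) (abs_nonneg _)
      _ = _ := by ring
  have near : |(∫ v in Icc (-P) P, wt k (p₁ t₁) v * arrivingDensity φ p₁ J₁ T t₁ v) -
      ∫ v in Icc (-P) P, wt k (p₂ t₂) v * arrivingDensity φ p₂ J₂ T t₂ v| ≤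
      2 * P * c₀ * Δ + 2 * c₁ * Δ + 2 * T * c₂ * Δ + c₃ * I := by
    have hS : MeasurableSet (hitSet p₁ T t₁ ∩ hitSet p₂ T t₂) :=
      (measurableSet_hitSet hT).inter (measurableSet_hitSet hT)
    have i0 : IntegrableOn (fun _ => c₀ * Δ) (Icc (-P) P) := integrableOn_const (by simp)
    have i1 : IntegrableOn (fun v => c₁ * |hasHit p₁ T t₁ v - hasHit p₂ T t₂ v|) (Icc (-P) P) :=
      ((((monotone_hasHit hT).monotoneOn _).integrableOn_isCompact isCompact_Icc).sub
        (((monotone_hasHit hT).monotoneOn _).integrableOn_isCompact isCompact_Icc)).abs.const_mul _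
    have i2 : IntegrableOn (fun v => c₂ * |lastLeave p₁ T t₁ v - lastLeave p₂ T t₂ v|)
        (Icc (-P) P) :=
      ((((monotone_lastHit hT).monotoneOn _).integrableOn_isCompact isCompact_Icc).sub
        (((monotone_lastHit hT).monotoneOn _).integrableOn_isCompact isCompact_Icc)).abs.const_mul _
    have i3' := (integrable_indicator_iff hS).2 (integrableOn_flux_diff h₁ h₂ ht₁ ht₂)
    have i3 : IntegrableOn (fun v => c₃ * (hitSet p₁ T t₁ ∩ hitSet p₂ T t₂).indicator
        (fun v => |J₁ (lastLeave p₁ T t₁ v) - J₂ (lastLeave p₂ T t₂ v)|) v) (Icc (-P) P) :=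
      (i3'.const_mul _).integrableOn
    have i01 : IntegrableOn (fun v => c₀ * Δ + c₁ * |hasHit p₁ T t₁ v - hasHit p₂ T t₂ v|)
      (Icc (-P) P) := i0.add i1
    have i012 : IntegrableOn (fun v => c₀ * Δ + c₁ * |hasHit p₁ T t₁ v - hasHit p₂ T t₂ v| +
      c₂ * |lastLeave p₁ T t₁ v - lastLeave p₂ T t₂ v|) (Icc (-P) P) := i01.add i2
    have i0123 : IntegrableOn (fun v => c₀ * Δ + c₁ * |hasHit p₁ T t₁ v - hasHit p₂ T t₂ v| +
      c₂ * |lastLeave p₁ T t₁ v - lastLeave p₂ T t₂ v| +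
      c₃ * (hitSet p₁ T t₁ ∩ hitSet p₂ T t₂).indicator
        (fun v => |J₁ (lastLeave p₁ T t₁ v) - J₂ (lastLeave p₂ T t₂ v)|) v) (Icc (-P) P) :=
      i012.add i3
    rw [← integral_sub
      (integrableOn_wt_mul_arrivingDensity hφ h₁.lipschitz h₁.abs_le hk ht₁.1 ht₁.2 h₁.integrableOn)
      (integrableOn_wt_mul_arrivingDensity hφ h₂.lipschitz h₂.abs_le hk ht₂.1 ht₂.2
        h₂.integrableOn), ← Real.norm_eq_abs]
    refine (norm_integral_le_of_norm_le i0123 ?_).trans ?_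
    · filter_upwards [ae_restrict_mem measurableSet_Icc] with v hv
      exact abs_wt_mul_arrivingDensity_sub_le hφ h₁ h₂ hk ht₂ hpt hp hv
    rw [integral_add i012 i3, integral_add i01 i2, integral_add i0 i1, setIntegral_const,
      integral_const_mul c₁, integral_const_mul c₂, integral_const_mul c₃]
    have hPP : -P ≤ P := by linarith
    have b0 : volume.real (Icc (-P) P) • (c₀ * Δ) = 2 * P * c₀ * Δ := by
      rw [Real.volume_real_Icc_of_le hPP, smul_eq_mul]; ring
    -- Here and in `b2` monotonicity in `v` is used: the L¹ distance is `2 * Δ` times the range,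
    -- which is 1 for `hasHit` and `T` for `lastLeave`.
    have b1 : ∫ v in Icc (-P) P, |hasHit p₁ T t₁ v - hasHit p₂ T t₂ v| ≤ 2 * Δ := by
      rw [integral_Icc_eq_integral_Ioc, ← intervalIntegral.integral_of_le hPP]
      refine (integral_abs_sub_le_of_shift (c := 0) (d := 1) (monotone_hasHit hT)
        (monotone_hasHit hT) (fun v => ?_) (fun v => ?_) hΔ (hasHit_le_shift hT hU')
        (hasHit_le_shift hT hU) hPP).trans_eq (by ring)
      · unfold hasHit; split_ifs <;> simp
      · unfold hasHit; split_ifs <;> simp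
    have b2 : ∫ v in Icc (-P) P, |lastLeave p₁ T t₁ v - lastLeave p₂ T t₂ v| ≤ 2 * Δ * T := by
      rw [integral_Icc_eq_integral_Ioc, ← intervalIntegral.integral_of_le hPP]
      exact (integral_abs_sub_le_of_shift (c := 0) (d := T) (monotone_lastHit hT)
        (monotone_lastHit hT) (fun v => lastHit_nonneg hT) (fun v => lastHit_le hT) hΔ
        (lastHit_le_shift hT hU') (lastHit_le_shift hT hU) hPP).trans_eq (by ring)
    have b3 : ∫ v in Icc (-P) P, (hitSet p₁ T t₁ ∩ hitSet p₂ T t₂).indicator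
        (fun v => |J₁ (lastLeave p₁ T t₁ v) - J₂ (lastLeave p₂ T t₂ v)|) v ≤ I := by
      refine (setIntegral_le_integral i3' (ae_of_all _ fun v =>
        indicator_nonneg (fun _ _ => abs_nonneg _) _)).trans_eq ?_
      rw [integral_indicator hS]
    rw [b0]
    have := mul_le_mul_of_nonneg_left b1 hc₁0
    have := mul_le_mul_of_nonneg_left b2 hc₂0
    have := mul_le_mul_of_nonneg_left b3 hc₃0
    linarith
  have e : ∀ a b c d : ℝ, a + b - (c + d) = (a - c) + (b - d) := fun a b c d => by ring
  rw [e]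
  refine (abs_add_le _ _).trans ?_
  have : 0 ≤ (K + 2 * P * c₀ + 2 * c₁ + 2 * T * c₂) * I := by positivity
  have : 0 ≤ c₃ * Δ := by positivity
  linarith

end Difference

/-! ### Lipschitz continuity of the flux and stability of the moments -/

/-- A bound for increments over short times gives a bound for all increments. -/
lemma abs_sub_le_of_short_increments {J : ℝ → ℝ} {l h W T : ℝ} (hl : 0 < l) (hh : 0 < h)
    (hW : 0 ≤ W) (H : ∀ a b, 0 ≤ a → a ≤ b → b ≤ T → b - a ≤ h →
      |J b - J a| ≤ W * Real.exp (l * b)) {a b : ℝ} (ha : 0 ≤ a) (hab : a ≤ b) (hb : b ≤ T) :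
    |J b - J a| ≤ W * (Real.exp (l * b) + (Real.exp (l * b) - Real.exp (l * a)) / (l * h)) := by
  have hmono : ∀ {x y : ℝ}, x ≤ y → Real.exp (l * x) ≤ Real.exp (l * y) := fun hxy =>
    Real.exp_le_exp.2 (by gcongr)
  have main : ∀ n : ℕ, ∀ b, a ≤ b → b ≤ T → b - a ≤ n * h → |J b - J a| ≤
      W * (Real.exp (l * b) + (Real.exp (l * b) - Real.exp (l * a)) / (l * h)) := by
    intro n
    induction n with
    | zero =>
      intro b hab hb hn
      have : b = a := by simp at hn; linarith
      subst this
      simp only [sub_self, abs_zero, zero_div, add_zero]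
      positivity
    | succ n ih =>
      intro b hab hb hn
      rcases le_or_gt (b - a) h with hs | hs
      · refine (H a b ha hab hb hs).trans (mul_le_mul_of_nonneg_left ?_ hW)
        have := hmono hab
        have : 0 ≤ (Real.exp (l * b) - Real.exp (l * a)) / (l * h) :=
          div_nonneg (by linarith) (by positivity)
        linarith
      · have h1 := ih (b - h) (by linarith) (by linarith) (by push_cast at hn; linarith)
        have h2 := H (b - h) b (by linarith) (by linarith) hb (by linarith)
        -- Each additional step of length `h` is paid for by an increment of the exponential,
        -- because `exp (l * h) ≥ 1 + l * h`; the increments telescope.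
        have h3 : Real.exp (l * (b - h)) ≤
            (Real.exp (l * b) - Real.exp (l * (b - h))) / (l * h) := by
          rw [le_div_iff₀ (by positivity)]
          have e : Real.exp (l * b) = Real.exp (l * (b - h)) * Real.exp (l * h) := by
            rw [← Real.exp_add]; congr 1; ring
          rw [e]
          have := Real.add_one_le_exp (l * h)
          nlinarith [Real.exp_pos (l * (b - h))]
        have h4 : |J b - J a| ≤ |J b - J (b - h)| + |J (b - h) - J a| := abs_sub_le _ _ _
        have h5 := mul_le_mul_of_nonneg_left h3 hW
        have e2 : (Real.exp (l * b) - Real.exp (l * a)) / (l * h) =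
            (Real.exp (l * b) - Real.exp (l * (b - h))) / (l * h) +
            (Real.exp (l * (b - h)) - Real.exp (l * a)) / (l * h) := by ring
        rw [e2]
        linarith
  obtain ⟨n, hn⟩ := exists_nat_ge ((b - a) / h)
  exact main n b hab hb (by rwa [div_le_iff₀ hh] at hn)

lemma integral_Icc_exp_le {l t : ℝ} (hl : 0 < l) (ht : 0 ≤ t) :
    ∫ s in Icc 0 t, Real.exp (l * s) ≤ Real.exp (l * t) / l := by
  rw [integral_Icc_eq_integral_Ioc, ← intervalIntegral.integral_of_le ht]
  have := intervalIntegral.mul_integral_comp_mul_left (a := 0) (b := t) (f := Real.exp) l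
  rw [integral_exp] at this
  rw [le_div_iff₀ hl, mul_comm, this]
  linarith [Real.exp_pos (l * 0)]

lemma integrableOn_exp_lastLeave {p : ℝ → ℝ} {L : NNReal} {T t : ℝ} (hp : LipschitzWith L p)
    (ht : 0 ≤ t) (htT : t ≤ T) (l : ℝ) :
    IntegrableOn (fun v => Real.exp (l * lastLeave p T t v)) (hitSet p T t) :=
  integrableOn_comp_lastHit hp ht htT (h := fun s => Real.exp (l * s))
    ((by fun_prop : Continuous fun s => Real.exp (l * s)).integrableOn_Icc)

/-- The factor `1 / l` makes the memory term of the integral equation absorbable for large `l`. -/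
lemma integral_exp_lastLeave_le {p : ℝ → ℝ} {L : NNReal} {T t l : ℝ} (hp : LipschitzWith L p)
    (ht : 0 ≤ t) (htT : t ≤ T) (hl : 0 < l) :
    ∫ v in hitSet p T t, Real.exp (l * lastLeave p T t v) ≤ L * (Real.exp (l * t) / l) := by
  refine (integral_comp_lastHit_le hp ht htT (h := fun s => Real.exp (l * s))
    ((by fun_prop : Continuous fun s => Real.exp (l * s)).integrableOn_Icc)
    fun s => (Real.exp_pos _).le).trans ?_
  have := integral_Icc_exp_le hl ht
  gcongr

/-- Integral bounds over the velocities which have hit the disk before for both trajectories. -/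
lemma integral_shift_le {p₁ p₂ : ℝ → ℝ} {P T t₁ t₂ Δ c d : ℝ} {f : ℝ → ℝ}
    (hp : Continuous p₁) (hP : ∀ s, |p₁ s| ≤ P) (hT : 0 ≤ T) (hΔ : 0 ≤ Δ)
    (hU : ∀ τ ∈ Icc 0 T, |velTo p₁ t₁ τ - velTo p₂ t₂ τ| ≤ Δ) (hf : Monotone f)
    (hc : ∀ s, 0 ≤ s → c ≤ f s) (hd : ∀ s, f s ≤ d) :
    IntegrableOn (fun v => |f (lastLeave p₁ T t₁ v) - f (lastLeave p₂ T t₂ v)|)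
      (hitSet p₁ T t₁ ∩ hitSet p₂ T t₂) ∧
    ∫ v in hitSet p₁ T t₁ ∩ hitSet p₂ T t₂,
      |f (lastLeave p₁ T t₁ v) - f (lastLeave p₂ T t₂ v)| ≤ 2 * Δ * (d - c) := by
  have hU' : ∀ τ ∈ Icc 0 T, |velTo p₂ t₂ τ - velTo p₁ t₁ τ| ≤ Δ := fun τ hτ => by
    rw [abs_sub_comm]; exact hU τ hτ
  have hPP : -P ≤ P := by linarith [(abs_nonneg _).trans (hP 0)]
  have m₁ : Monotone fun v => f (lastLeave p₁ T t₁ v) := hf.comp (monotone_lastHit hT)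
  have m₂ : Monotone fun v => f (lastLeave p₂ T t₂ v) := hf.comp (monotone_lastHit hT)
  have hsub : hitSet p₁ T t₁ ∩ hitSet p₂ T t₂ ⊆ Icc (-P) P :=
    inter_subset_left.trans (hitSet_subset hp hT hP)
  have i : IntegrableOn (fun v => |f (lastLeave p₁ T t₁ v) - f (lastLeave p₂ T t₂ v)|)
      (Icc (-P) P) :=
    (((m₁.monotoneOn _).integrableOn_isCompact isCompact_Icc).sub
      ((m₂.monotoneOn _).integrableOn_isCompact isCompact_Icc)).abs
  refine ⟨i.mono_set hsub, ?_⟩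
  refine (setIntegral_mono_set i (ae_of_all _ fun v => abs_nonneg _)
    (ae_of_all _ hsub)).trans ?_
  rw [integral_Icc_eq_integral_Ioc, ← intervalIntegral.integral_of_le hPP]
  exact integral_abs_sub_le_of_shift (c := c) (d := d) m₁ m₂ (fun v => hc _ (lastHit_nonneg hT))
    (fun v => hd _) hΔ (fun v => hf (lastHit_le_shift hT hU' v))
    (fun v => hf (lastHit_le_shift hT hU v)) hPP

/-- The mass flux into the disk is Lipschitz continuous in time. -/
lemma exists_lipschitz_flux {φ p J : ℝ → ℝ} {L : NNReal} {B P Q T : ℝ}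
    (hφ : IsInitialDensity φ B P) (hT : 0 ≤ T) (h : IsFlow L P Q T p J)
    (hJ : ∀ t ∈ Icc 0 T, J t = moment φ p J T 1 t) :
    ∃ Λ, 0 ≤ Λ ∧ ∀ s ∈ Icc 0 T, ∀ t ∈ Icc 0 T, |J s - J t| ≤ Λ * |s - t| := by
  have hP0 : 0 ≤ P := (abs_nonneg _).trans (h.abs_le 0)
  have hQ : 0 ≤ Q := (abs_nonneg _).trans (h.abs_flux_le 0 ⟨le_rfl, hT⟩)
  obtain ⟨C, hC, hdiff⟩ := exists_abs_moment_sub_le hφ hP0 hT hQ L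
  -- The memory terms below add up to `6 * C * L / l` times `W`; this choice makes the factor at
  -- most `1 / 2`.
  set l : ℝ := 12 * C * L + 1 with hl
  have hl0 : 0 < l := by positivity
  have key : ∀ a b, 0 ≤ a → a < b → b ≤ T → |J b - J a| ≤ 4 * L * C * (b - a) * Real.exp (l * b) := by
    intro a₀ b₀ ha₀ hab₀ hb₀
    set δ := b₀ - a₀ with hδ
    have hδ0 : 0 < δ := sub_pos.2 hab₀
    -- The increment length is fixed at `δ`, and the weighted supremum over increments of at most
    -- that length is finite because `J` is bounded. The aim is a bound linear in `δ`.
    set A : Set ℝ := {x | ∃ a b, 0 ≤ a ∧ a ≤ b ∧ b ≤ T ∧ b - a ≤ δ ∧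
      x = |J b - J a| * Real.exp (-(l * b))} with hA
    have hAb : BddAbove A := by
      refine ⟨2 * Q, ?_⟩
      rintro x ⟨a, b, ha, hab, hb, -, rfl⟩
      have h1 := h.abs_flux_le a ⟨ha, hab.trans hb⟩
      have h2 := h.abs_flux_le b ⟨ha.trans hab, hb⟩
      have h3 : |J b - J a| ≤ 2 * Q := (abs_sub _ _).trans (by linarith)
      have h4 : Real.exp (-(l * b)) ≤ 1 := Real.exp_le_one_iff.2 (by
        have := mul_nonneg hl0.le (ha.trans hab); linarith)
      exact (mul_le_of_le_one_right (abs_nonneg _) h4).trans h3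
    set W := sSup A with hW
    have hmem : |J b₀ - J a₀| * Real.exp (-(l * b₀)) ∈ A :=
      ⟨a₀, b₀, ha₀, hab₀.le, hb₀, le_rfl, rfl⟩
    have hW0 : 0 ≤ W := le_trans (by positivity) (le_csSup hAb hmem)
    have hWle : ∀ a b, 0 ≤ a → a ≤ b → b ≤ T → b - a ≤ δ →
        |J b - J a| ≤ W * Real.exp (l * b) := by
      intro a b ha hab hb hd
      have := le_csSup hAb ⟨a, b, ha, hab, hb, hd, rfl⟩
      rwa [Real.exp_neg, ← div_eq_mul_inv, div_le_iff₀ (Real.exp_pos _)] at this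
    -- Two collision times may be far apart even when the arrival times are within `δ`, so
    -- increments of arbitrary length must be bounded in terms of `W`.
    have hany : ∀ a b, 0 ≤ a → 0 ≤ b → a ≤ T → b ≤ T → |J a - J b| ≤
        W * (Real.exp (l * a) + Real.exp (l * b) +
          |Real.exp (l * a) - Real.exp (l * b)| / (l * δ)) := by
      intro a b ha hb haT hbT
      rcases le_total a b with hab | hab
      · have := abs_sub_le_of_short_increments hl0 hδ0 hW0 hWle ha hab hbT
        rw [abs_sub_comm, abs_sub_comm (Real.exp _)]
        refine this.trans (mul_le_mul_of_nonneg_left (add_le_add ?_ ?_) hW0)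
        · linarith [Real.exp_pos (l * a)]
        · gcongr
          exact le_abs_self _
      · have := abs_sub_le_of_short_increments hl0 hδ0 hW0 hWle hb hab haT
        refine this.trans (mul_le_mul_of_nonneg_left (add_le_add ?_ ?_) hW0)
        · linarith [Real.exp_pos (l * b)]
        · gcongr
          exact le_abs_self _
    have hWself : W ≤ 2 * L * C * δ + W / 2 := by
      refine csSup_le ⟨_, hmem⟩ ?_
      rintro x ⟨a, b, ha, hab, hb, hd, rfl⟩
      have haT := hab.trans hb
      have hb0 := ha.trans hab
      have hΔ : 0 ≤ 2 * L * (b - a) := by have := sub_nonneg.2 hab; positivity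
      have hU : ∀ τ ∈ Icc 0 T, |velTo p b τ - velTo p a τ| ≤ 2 * L * (b - a) := fun τ _ => by
        have := abs_velTo_sub_le h.lipschitz b a τ
        rwa [abs_of_nonneg (sub_nonneg.2 hab)] at this
      have h1 := hdiff 1 p p J J b a (2 * L * (b - a)) (Or.inl rfl) h h ⟨hb0, hb⟩ ⟨ha, haT⟩
        hU (fun s _ => by simpa using hΔ)
      rw [← hJ b ⟨hb0, hb⟩, ← hJ a ⟨ha, haT⟩] at h1
      -- Truncation at `b` gives a global upper bound without changing the values at the leave times
      -- involved, which are at most `b`.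
      set f : ℝ → ℝ := fun s => Real.exp (l * min s b) with hf
      have hfm : Monotone f := fun x y hxy => Real.exp_le_exp.2 (by gcongr)
      obtain ⟨is, hs⟩ := integral_shift_le (c := 0) (d := Real.exp (l * b)) h.lipschitz.continuous
        h.abs_le hT hΔ hU hfm
        (fun s _ => (Real.exp_pos _).le)
        (fun s => Real.exp_le_exp.2 (by gcongr; exact min_le_right _ _))
      have ib := (integrableOn_exp_lastLeave h.lipschitz hb0 hb l).mono_set
        (inter_subset_left (t := hitSet p T a))
      have ia := (integrableOn_exp_lastLeave h.lipschitz ha haT l).mono_set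
        (inter_subset_right (s := hitSet p T b))
      have hS : MeasurableSet (hitSet p T b ∩ hitSet p T a) :=
        (measurableSet_hitSet hT).inter (measurableSet_hitSet hT)
      have hI : ∫ v in hitSet p T b ∩ hitSet p T a,
          |J (lastLeave p T b v) - J (lastLeave p T a v)| ≤
          W * (L * (Real.exp (l * b) / l) + L * (Real.exp (l * b) / l) +
            2 * (2 * L * (b - a)) * (Real.exp (l * b) - 0) / (l * δ)) := by
        have iab : IntegrableOn (fun v => Real.exp (l * lastLeave p T b v) +
          Real.exp (l * lastLeave p T a v)) (hitSet p T b ∩ hitSet p T a) := ib.add ia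
        refine (setIntegral_mono_on (integrableOn_flux_diff h h ⟨hb0, hb⟩ ⟨ha, haT⟩)
          ((iab.add (is.div_const (l * δ))).const_mul W) hS fun v hv => ?_).trans ?_
        · have e1 := lastHit_velTo_le (T := T) hb0 hv.1.1
          have e2 := lastHit_velTo_le (T := T) ha hv.2.1
          have e3 := hany (lastLeave p T b v) (lastLeave p T a v) (lastHit_nonneg hT)
            (lastHit_nonneg hT) (lastHit_le hT) (lastHit_le hT)
          simp only [hf, Pi.add_apply]
          rw [min_eq_left e1, min_eq_left (e2.trans hab)]
          exact e3
        · rw [integral_const_mul]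
          simp only [Pi.add_apply]
          rw [integral_add iab (is.div_const _), integral_add ib ia, integral_div]
          refine mul_le_mul_of_nonneg_left (add_le_add (add_le_add ?_ ?_) ?_) hW0
          · refine le_trans ?_ (integral_exp_lastLeave_le h.lipschitz hb0 hb hl0)
            exact setIntegral_mono_set (integrableOn_exp_lastLeave h.lipschitz hb0 hb l)
              (ae_of_all _ fun v => (Real.exp_pos _).le) (ae_of_all _ inter_subset_left)
          · refine (le_trans ?_ (integral_exp_lastLeave_le h.lipschitz ha haT hl0)).trans ?_
            · exact setIntegral_mono_set (integrableOn_exp_lastLeave h.lipschitz ha haT l)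
                (ae_of_all _ fun v => (Real.exp_pos _).le) (ae_of_all _ inter_subset_right)
            · gcongr
          · gcongr
      -- The loss `1 / δ` from chaining short increments is cancelled by `b - a ≤ δ`, gained from
      -- the shift estimate.
      have hfrac : 2 * (2 * L * (b - a)) * (Real.exp (l * b) - 0) / (l * δ) ≤
          4 * L * (Real.exp (l * b) / l) := by
        rw [sub_zero, div_le_iff₀ (by positivity)]
        have e : 4 * L * (Real.exp (l * b) / l) * (l * δ) = 4 * L * Real.exp (l * b) * δ := by
          field_simp
        rw [e]
        have : (0 : ℝ) ≤ 4 * L * Real.exp (l * b) := by positivity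
        nlinarith
      have hCl : C * (W * (6 * L * (Real.exp (l * b) / l))) ≤ W / 2 * Real.exp (l * b) := by
        have e : C * (W * (6 * L * (Real.exp (l * b) / l))) =
          (6 * C * L / l) * (W * Real.exp (l * b)) := by ring
        have : 6 * C * L / l ≤ 1 / 2 := by
          rw [div_le_iff₀ hl0, hl]; linarith
        rw [e]
        calc _ ≤ 1 / 2 * (W * Real.exp (l * b)) := by gcongr
          _ = _ := by ring
      have hI2 := mul_le_mul_of_nonneg_left hfrac hW0
      have hI3 := mul_le_mul_of_nonneg_left (hI.trans
        (by linarith : _ ≤ W * (6 * L * (Real.exp (l * b) / l)))) hC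
      rw [Real.exp_neg, ← div_eq_mul_inv, div_le_iff₀ (Real.exp_pos _)]
      have h1e : 1 ≤ Real.exp (l * b) := Real.one_le_exp (by positivity)
      have h8 : C * (2 * L * (b - a)) ≤ 2 * L * C * δ * Real.exp (l * b) := by
        have : C * (2 * L * (b - a)) ≤ C * (2 * L * δ) := by gcongr
        have h9 : (0 : ℝ) ≤ C * (2 * L * δ) := by positivity
        nlinarith
      linarith
    have := hWle a₀ b₀ ha₀ hab₀.le hb₀ le_rfl
    refine this.trans ?_
    gcongr
    linarith
  refine ⟨4 * L * C * Real.exp (l * T), by positivity, ?_⟩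
  have key' : ∀ a ∈ Icc 0 T, ∀ b ∈ Icc 0 T, a < b →
      |J b - J a| ≤ 4 * L * C * Real.exp (l * T) * |b - a| := by
    intro a ha b hb hab
    refine (key a b ha.1 hab hb.2).trans ?_
    rw [abs_of_pos (sub_pos.2 hab)]
    have : Real.exp (l * b) ≤ Real.exp (l * T) := Real.exp_le_exp.2 (by have := hb.2; gcongr)
    have h9 : (0 : ℝ) ≤ 4 * L * C * (b - a) := by have := sub_pos.2 hab; positivity
    nlinarith
  intro s hs t ht
  rcases lt_trichotomy s t with hst | rfl | hst
  · rw [abs_sub_comm, abs_sub_comm s]; exact key' s hs t ht hst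
  · simp
  · exact key' t ht s hs hst

/-- The moments of the density arriving at the disk are controlled by the disk velocity. -/
lemma exists_moment_stability {φ p₁ p₂ J₁ J₂ : ℝ → ℝ} {L : NNReal} {B P Q T : ℝ}
    (hφ : IsInitialDensity φ B P) (hT : 0 ≤ T) (h₁ : IsFlow L P Q T p₁ J₁)
    (h₂ : IsFlow L P Q T p₂ J₂) (hJ₁ : ∀ t ∈ Icc 0 T, J₁ t = moment φ p₁ J₁ T 1 t)
    (hJ₂ : ∀ t ∈ Icc 0 T, J₂ t = moment φ p₂ J₂ T 1 t) :
    ∃ C, 0 < C ∧ ∀ l ≥ C, ∀ D ≥ 0, (∀ t ∈ Icc 0 T, |p₁ t - p₂ t| ≤ D * Real.exp (l * t)) →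
      ∀ k, (k = 1 ∨ k = 2) → ∀ t ∈ Icc 0 T,
        |moment φ p₁ J₁ T k t - moment φ p₂ J₂ T k t| ≤ C * D * Real.exp (l * t) := by
  have hP0 : 0 ≤ P := (abs_nonneg _).trans (h₁.abs_le 0)
  have hQ : 0 ≤ Q := (abs_nonneg _).trans (h₁.abs_flux_le 0 ⟨le_rfl, hT⟩)
  obtain ⟨C₀, hC₀, hdiff⟩ := exists_abs_moment_sub_le hφ hP0 hT hQ L
  obtain ⟨Λ, hΛ, hlip⟩ := exists_lipschitz_flux hφ hT h₁ hJ₁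
  set C₁ := C₀ * (1 + 2 * Λ * T) with hC₁
  have hC₁0 : 0 ≤ C₁ := by positivity
  -- The term `2 * C₁` is the final bound after absorption, and `2 * C₀ * L` forces `C₀ * L / l ≤ 1
  -- / 2`.
  refine ⟨2 * C₁ + 2 * C₀ * L + 1, by positivity, ?_⟩
  intro l hl D hD hp
  have hl0 : 0 < l := by
    refine lt_of_lt_of_le ?_ hl
    positivity
  set A : Set ℝ := {x | ∃ t ∈ Icc 0 T, x = |J₁ t - J₂ t| * Real.exp (-(l * t))} with hA
  have hAb : BddAbove A := by
    refine ⟨2 * Q, ?_⟩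
    rintro x ⟨t, ht, rfl⟩
    have h3 : |J₁ t - J₂ t| ≤ 2 * Q :=
      (abs_sub _ _).trans (by linarith [h₁.abs_flux_le t ht, h₂.abs_flux_le t ht])
    have h4 : Real.exp (-(l * t)) ≤ 1 := Real.exp_le_one_iff.2 (by
      have := mul_nonneg hl0.le ht.1; linarith)
    exact (mul_le_of_le_one_right (abs_nonneg _) h4).trans h3
  set E := sSup A with hE
  have hmem : |J₁ 0 - J₂ 0| * Real.exp (-(l * 0)) ∈ A := ⟨0, ⟨le_rfl, hT⟩, rfl⟩
  have hE0 : 0 ≤ E := le_trans (by positivity) (le_csSup hAb hmem)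
  have hEle : ∀ t ∈ Icc 0 T, |J₁ t - J₂ t| ≤ E * Real.exp (l * t) := by
    intro t ht
    have := le_csSup hAb ⟨t, ht, rfl⟩
    rwa [Real.exp_neg, ← div_eq_mul_inv, div_le_iff₀ (Real.exp_pos _)] at this
  have main : ∀ k, (k = 1 ∨ k = 2) → ∀ t ∈ Icc 0 T,
      |moment φ p₁ J₁ T k t - moment φ p₂ J₂ T k t| ≤ (C₁ * D + E / 2) * Real.exp (l * t) := by
    intro k hk t ht
    have hpt : ∀ s ∈ Icc 0 t, |p₁ s - p₂ s| ≤ D * Real.exp (l * t) := fun s hs => by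
      refine (hp s ⟨hs.1, hs.2.trans ht.2⟩).trans ?_
      have := hs.2
      gcongr
    have hU : ∀ τ ∈ Icc 0 T, |velTo p₁ t τ - velTo p₂ t τ| ≤ D * Real.exp (l * t) :=
      fun τ hτ => abs_velTo_sub_velTo_le h₁.lipschitz.continuous h₂.lipschitz.continuous hτ.1
        ht.1 hpt
    have h1 := hdiff k p₁ p₂ J₁ J₂ t t _ hk h₁ h₂ ht ht hU hpt
    have hΔ : 0 ≤ D * Real.exp (l * t) := by positivity
    obtain ⟨is, hs⟩ := integral_shift_le (c := 0) (d := T) (f := fun s => min s T)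
      h₁.lipschitz.continuous h₁.abs_le hT hΔ hU (monotone_id.min monotone_const)
      (fun s hs => le_min hs hT) (fun s => min_le_right _ _)
    have i2 := (integrableOn_exp_lastLeave h₂.lipschitz ht.1 ht.2 l).mono_set
        (inter_subset_right (s := hitSet p₁ T t))
    have hS : MeasurableSet (hitSet p₁ T t ∩ hitSet p₂ T t) :=
      (measurableSet_hitSet hT).inter (measurableSet_hitSet hT)
    have hI : ∫ v in hitSet p₁ T t ∩ hitSet p₂ T t,
        |J₁ (lastLeave p₁ T t v) - J₂ (lastLeave p₂ T t v)| ≤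
        Λ * (2 * (D * Real.exp (l * t)) * (T - 0)) + E * (L * (Real.exp (l * t) / l)) := by
      refine (setIntegral_mono_on (integrableOn_flux_diff h₁ h₂ ht ht)
        ((is.const_mul Λ).add (i2.const_mul E)) hS fun v hv => ?_).trans ?_
      · have m1 : lastLeave p₁ T t v ∈ Icc 0 T := ⟨lastHit_nonneg hT, lastHit_le hT⟩
        have m2 : lastLeave p₂ T t v ∈ Icc 0 T := ⟨lastHit_nonneg hT, lastHit_le hT⟩
        simp only [Pi.add_apply]
        rw [min_eq_left m1.2, min_eq_left m2.2]
        -- Time regularity of `J₁` handles the different collision times; the remaining difference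
        -- is at the common time of the second trajectory.
        exact (abs_sub_le _ (J₁ (lastLeave p₂ T t v)) _).trans
          (add_le_add (hlip _ m1 _ m2) (hEle _ m2))
      · simp only [Pi.add_apply]
        rw [integral_add (is.const_mul Λ) (i2.const_mul E), integral_const_mul,
          integral_const_mul]
        refine add_le_add (mul_le_mul_of_nonneg_left hs hΛ) (mul_le_mul_of_nonneg_left ?_ hE0)
        refine le_trans ?_ (integral_exp_lastLeave_le h₂.lipschitz ht.1 ht.2 hl0)
        exact setIntegral_mono_set (integrableOn_exp_lastLeave h₂.lipschitz ht.1 ht.2 l)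
          (ae_of_all _ fun v => (Real.exp_pos _).le) (ae_of_all _ inter_subset_right)
    have hI2 := mul_le_mul_of_nonneg_left hI hC₀
    have hCl : C₀ * (E * (L * (Real.exp (l * t) / l))) ≤ E / 2 * Real.exp (l * t) := by
      have e : C₀ * (E * (L * (Real.exp (l * t) / l))) =
        (C₀ * L / l) * (E * Real.exp (l * t)) := by ring
      have : C₀ * L / l ≤ 1 / 2 := by
        rw [div_le_iff₀ hl0]; linarith
      rw [e]
      calc _ ≤ 1 / 2 * (E * Real.exp (l * t)) := by gcongr
        _ = _ := by ring
    have e5 : C₁ * D * Real.exp (l * t) = C₀ * (D * Real.exp (l * t)) +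
      C₀ * (Λ * (2 * (D * Real.exp (l * t)) * (T - 0))) := by rw [hC₁]; ring
    linarith
  have hEself : E ≤ C₁ * D + E / 2 := by
    refine csSup_le ⟨_, hmem⟩ ?_
    rintro x ⟨t, ht, rfl⟩
    rw [Real.exp_neg, ← div_eq_mul_inv, div_le_iff₀ (Real.exp_pos _), hJ₁ t ht, hJ₂ t ht]
    exact main 1 (Or.inl rfl) t ht
  intro k hk t ht
  refine (main k hk t ht).trans ?_
  gcongr
  have : 0 ≤ (2 * C₀ * L + 1) * D := by positivity
  linarith

/-! ### Null sets and trajectories -/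

/-- Near a point with positive derivative `g` is injective with derivative bounded below, so by
change of variables the preimage of a null set is locally null. -/
lemma ae_of_ae_deriv_pos {g g' : ℝ → ℝ} (hg : Continuous g)
    (hd : ∀ t, 0 < t → HasDerivAt g (g' t) t) (hc : ContinuousOn g' (Ioi 0)) {q : ℝ → Prop}
    (hq : ∀ᵐ y, q y) : ∀ᵐ t : ℝ, 0 < t → 0 < g' t → q (g t) := by
  set N := toMeasurable volume {y | ¬ q y} with hN
  have hN0 : volume N = 0 := by rw [hN, measure_toMeasurable]; exact hq
  have hNm : MeasurableSet N := measurableSet_toMeasurable _ _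
  have hs : volume {t | 0 < t ∧ 0 < g' t ∧ g t ∈ N} = 0 := by
    refine measure_null_of_locally_null _ ?_
    rintro x ⟨hx0, hx, hxN⟩
    have hnhds : {t | 0 < t ∧ g' x / 2 < g' t} ∈ 𝓝 x :=
      inter_mem (Ioi_mem_nhds hx0)
        ((hc.continuousAt (Ioi_mem_nhds hx0)).eventually_const_lt (by linarith))
    obtain ⟨ε, hε, hball⟩ := Metric.mem_nhds_iff.1 hnhds
    rw [Real.ball_eq_Ioo] at hball
    set I := Ioo (x - ε) (x + ε) with hI
    set A := I ∩ g ⁻¹' N with hA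
    have hAm : MeasurableSet A := measurableSet_Ioo.inter (hg.measurable hNm)
    refine ⟨A, ?_, ?_⟩
    · refine mem_nhdsWithin_iff_exists_mem_nhds_inter.2
        ⟨I, Ioo_mem_nhds (by linarith) (by linarith), ?_⟩
      rintro t ⟨htI, -, -, htN⟩
      exact ⟨htI, htN⟩
    have hmono : StrictMonoOn g I := by
      refine strictMonoOn_of_deriv_pos (convex_Ioo _ _) hg.continuousOn fun t ht => ?_
      rw [interior_Ioo] at ht
      rw [(hd t (hball ht).1).deriv]
      linarith [(hball ht).2]
    have hcov := lintegral_image_eq_lintegral_abs_deriv_mul (f := g) (f' := g') hAm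
      (fun t ht => (hd t (hball ht.1).1).hasDerivWithinAt) (hmono.injOn.mono inter_subset_left)
      (fun _ => 1)
    have himg : volume (g '' A) = 0 :=
      measure_mono_null (image_subset_iff.2 inter_subset_right) hN0
    rw [lintegral_one, Measure.restrict_apply_univ, himg] at hcov
    have hle : ENNReal.ofReal (g' x / 2) * volume A ≤ 0 := by
      rw [hcov, ← setLIntegral_const]
      refine setLIntegral_mono' hAm fun t ht => ?_
      rw [mul_one]
      exact ENNReal.ofReal_le_ofReal ((hball ht.1).2.le.trans (le_abs_self _))
    rcases mul_eq_zero.1 (nonpos_iff_eq_zero.1 hle) with h | h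
    · rw [ENNReal.ofReal_eq_zero] at h
      linarith
    · exact h
  have : ∀ᵐ t, t ∉ {t | 0 < t ∧ 0 < g' t ∧ g t ∈ N} := measure_eq_zero_iff_ae_notMem.1 hs
  filter_upwards [this] with t ht h0 hpos
  by_contra hcon
  exact ht ⟨h0, hpos, subset_toMeasurable _ _ hcon⟩

lemma ae_of_ae_deriv_ne_zero {g g' : ℝ → ℝ} (hg : Continuous g)
    (hd : ∀ t, 0 < t → HasDerivAt g (g' t) t) (hc : ContinuousOn g' (Ioi 0)) {q : ℝ → Prop}
    (hq : ∀ᵐ y, q y) : ∀ᵐ t : ℝ, 0 < t → g' t ≠ 0 → q (g t) := by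
  have hq' : ∀ᵐ y : ℝ, q (-y) :=
    (Measure.measurePreserving_neg (volume : Measure ℝ)).quasiMeasurePreserving.ae hq
  filter_upwards [ae_of_ae_deriv_pos hg hd hc hq,
    ae_of_ae_deriv_pos hg.neg (fun t ht => (hd t ht).neg) hc.neg hq'] with t h1 h2 h0 hne
  rcases lt_or_gt_of_ne hne with h | h
  · simpa using h2 h0 (by simpa using h)
  · exact h1 h0 h

section Frame

variable {η p : ℝ → ℝ}

lemma hasDerivAt_of_position (hη : ∀ t : ℝ, 0 ≤ t → HasDerivWithinAt η (p t) (Ici 0) t) {t : ℝ}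
    (ht : 0 < t) : HasDerivAt η (p t) t :=
  (hη t ht.le).hasDerivAt (Ici_mem_nhds ht)

lemma continuousOn_of_position (hη : ∀ t : ℝ, 0 ≤ t → HasDerivWithinAt η (p t) (Ici 0) t) :
    ContinuousOn η (Ici 0) := fun t ht => (hη t ht).continuousWithinAt

/-- Almost every trajectory meets the disk only at times and with velocities which are generic. -/
lemma ae_trajectory_of_ae (hη : ∀ t : ℝ, 0 ≤ t → HasDerivWithinAt η (p t) (Ici 0) t)
    {q : ℝ × ℝ → Prop} (hq : ∀ᵐ z : ℝ × ℝ, 0 < z.1 → q z) :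
    ∀ᵐ z : ℝ × ℝ, ∀ τ, 0 < τ → η τ = z.1 + τ * z.2 → q (τ, z.2) := by
  set S : Set (ℝ × ℝ) := {z | ¬ (0 < z.1 → q z)} with hS
  have h0 : volume S = 0 := hq
  -- A trajectory through the disk at `(τ, v)` starts at `η τ - τ * v`. This map is differentiable
  -- in `(τ, v)`, so it sends null sets to null sets, injective or not.
  have himg : volume ((fun z : ℝ × ℝ => (η z.1 - z.1 * z.2, z.2)) '' S) = 0 := by
    refine addHaar_image_eq_zero_of_differentiableOn_of_addHaar_eq_zero volume ?_ h0
    intro z hz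
    have hz0 : 0 < z.1 := by
      by_contra h
      exact hz fun h' => absurd h' h
    have h1 : DifferentiableAt ℝ (fun z : ℝ × ℝ => η z.1) z :=
      (hasDerivAt_of_position hη hz0).differentiableAt.comp z differentiableAt_fst
    exact ((h1.sub (differentiableAt_fst.mul differentiableAt_snd)).prodMk
      differentiableAt_snd).differentiableWithinAt
  filter_upwards [measure_eq_zero_iff_ae_notMem.1 himg] with z hz τ hτ hmeet
  by_contra hcon
  refine hz ⟨(τ, z.2), fun h => hcon (h hτ), ?_⟩
  simp [hmeet]

/-- Almost every trajectory passing the disk is generic. -/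
lemma ae_arrival_of_ae (hη : ∀ t : ℝ, 0 ≤ t → HasDerivWithinAt η (p t) (Ici 0) t)
    (hp : ContinuousOn p (Ici 0)) {q : ℝ × ℝ → Prop} (hq : ∀ᵐ z : ℝ × ℝ, q z) :
    ∀ᵐ z : ℝ × ℝ, 0 < z.1 → z.2 ≠ p z.1 → q (η z.1 - z.1 * z.2, z.2) := by
  set η' : ℝ → ℝ := fun t => η (max 0 t) with hη'
  set p' : ℝ → ℝ := fun t => p (max 0 t) with hp'
  have hη'c : Continuous η' :=
    (continuousOn_of_position hη).comp_continuous (by fun_prop) fun t => mem_Ici.2 (le_max_left _ _)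
  have hp'c : Continuous p' := hp.comp_continuous (by fun_prop) fun t => mem_Ici.2 (le_max_left _ _)
  have hη'd : ∀ t, 0 < t → HasDerivAt η' (p' t) t := fun t ht => by
    have h1 : p' t = p t := by simp [hp', max_eq_right ht.le]
    rw [h1]
    refine (hasDerivAt_of_position hη ht).congr_of_eventuallyEq ?_
    filter_upwards [Ioi_mem_nhds ht] with s hs
    simp [hη', max_eq_right (mem_Ioi.1 hs).le]
  -- The converse transfer pulls a null set back. It is done for fixed `v`, where the start position
  -- has derivative `p t - v` in `t`; a measurable hull is needed for Fubini.
  set N := toMeasurable volume {z : ℝ × ℝ | ¬ q z} with hN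
  have hN0 : volume N = 0 := by rw [hN, measure_toMeasurable]; exact hq
  have hNm : MeasurableSet N := measurableSet_toMeasurable _ _
  have hsec : ∀ᵐ v : ℝ, ∀ᵐ y : ℝ, (y, v) ∉ N := by
    have h1 : ∀ᵐ z ∂((volume : Measure ℝ).prod (volume : Measure ℝ)), z ∉ N :=
      measure_eq_zero_iff_ae_notMem.1 hN0
    exact (Measure.ae_ae_comm (p := fun y v => (y, v) ∉ N) hNm.compl).1
      (Measure.ae_ae_of_ae_prod h1)
  have hG : MeasurableSet {z : ℝ × ℝ | 0 < z.1 → p' z.1 - z.2 ≠ 0 →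
      (η' z.1 - z.1 * z.2, z.2) ∉ N} := by
    have m1 : MeasurableSet {z : ℝ × ℝ | 0 < z.1} := measurableSet_lt measurable_const measurable_fst
    have m2 : MeasurableSet {z : ℝ × ℝ | p' z.1 - z.2 = 0} :=
      measurableSet_eq_fun (by fun_prop) measurable_const
    have m3 : MeasurableSet {z : ℝ × ℝ | (η' z.1 - z.1 * z.2, z.2) ∈ N} :=
      (by fun_prop : Measurable fun z : ℝ × ℝ => (η' z.1 - z.1 * z.2, z.2)) hNm
    have := (m1.inter (m2.compl.inter m3)).compl
    convert this using 1
    ext z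
    simp only [mem_ofPred_eq, mem_compl_iff, mem_inter_iff]
    tauto
  have hmain : ∀ᵐ z : ℝ × ℝ, 0 < z.1 → p' z.1 - z.2 ≠ 0 → (η' z.1 - z.1 * z.2, z.2) ∉ N := by
    refine (Measure.ae_prod_iff_ae_ae hG).2 ?_
    refine (Measure.ae_ae_comm (p := fun t v => 0 < t → p' t - v ≠ 0 →
      (η' t - t * v, v) ∉ N) hG).2 ?_
    filter_upwards [hsec] with v hv
    refine ae_of_ae_deriv_ne_zero (g := fun t => η' t - t * v) (g' := fun t => p' t - v)
      (by fun_prop) (fun t ht => ?_) (by fun_prop) hv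
    simpa using (hη'd t ht).fun_sub ((hasDerivAt_id t).mul_const v)
  filter_upwards [hmain] with z hz h0 hne
  have e1 : p' z.1 = p z.1 := by simp [hp', max_eq_right h0.le]
  have e2 : η' z.1 = η z.1 := by simp [hη', max_eq_right h0.le]
  have := hz h0 (by rw [e1]; exact fun h => hne (by linarith))
  rw [e2] at this
  by_contra hcon
  exact this (subset_toMeasurable _ _ hcon)

/-- Almost no trajectory moves with the velocity of the disk. -/
lemma ae_ne_velocity (hp : ContinuousOn p (Ici 0)) : ∀ᵐ z : ℝ × ℝ, 0 < z.1 → z.2 ≠ p z.1 := by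
  set p' : ℝ → ℝ := fun t => p (max 0 t) with hp'
  have hp'c : Continuous p' := hp.comp_continuous (by fun_prop) fun t => mem_Ici.2 (le_max_left _ _)
  have hm : MeasurableSet {z : ℝ × ℝ | z.2 ≠ p' z.1} :=
    (measurableSet_eq_fun measurable_snd (by fun_prop)).compl
  have : ∀ᵐ z : ℝ × ℝ, z.2 ≠ p' z.1 :=
    (Measure.ae_prod_iff_ae_ae hm).2 (ae_of_all _ fun t => Measure.ae_ne volume (p' t))
  filter_upwards [this] with z hz h0
  simpa [hp', max_eq_right h0.le] using hz

end Frame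

/-! ### The gas on the right of the disk -/

/-- The mass flux into the disk from the right. -/
noncomputable def inflow (η p : ℝ → ℝ) (f : ℝ → ℝ → ℝ → ℝ) (t : ℝ) : ℝ :=
  ∫ w in Iio (p t), (p t - w) * preTrace η f t w

/-- The part of the gas-disk system that concerns the gas on the right of the disk. -/
structure IsRightGas (φ η p : ℝ → ℝ) (f : ℝ → ℝ → ℝ → ℝ) : Prop where
  integrable : ∀ R : ℝ, IntegrableOn (fun z : ℝ × ℝ × ℝ => f z.1 z.2.1 z.2.2)
    (Icc (-R) R ×ˢ Icc (-R) R ×ˢ Icc 0 R)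
  initial : ∀ᵐ z : ℝ × ℝ, f z.1 z.2 0 = φ z.2
  transport : ∀ᵐ z : ℝ × ℝ, ∀ s t : ℝ, 0 ≤ s → s ≤ t →
    (∀ τ ∈ Icc s t, z.1 + τ * z.2 ≠ η τ) → f (z.1 + s * z.2) z.2 s = f (z.1 + t * z.2) z.2 t
  momentum_integrable : ∀ᵐ t : ℝ, 0 < t → Integrable (fun v => (v - p t) ^ 2 * preTrace η f t v)
  boundary : ∀ᵐ z : ℝ × ℝ, 0 < z.1 → p z.1 < z.2 →
    postTrace η f z.1 z.2 = 2 * Real.exp (-(z.2 - p z.1) ^ 2) * inflow η p f z.1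
  position_zero : η 0 = 0
  position_deriv : ∀ t : ℝ, 0 ≤ t → HasDerivWithinAt η (p t) (Ici 0) t
  velocity_continuous : ContinuousOn p (Ici 0)

/-- The density along the trajectory `τ ↦ (y + τ v, v)` to the right of the disk is given by the
initial density before the first collision, and by the boundary condition after a collision. -/
structure IsRegular (φ η p J : ℝ → ℝ) (f : ℝ → ℝ → ℝ → ℝ) (y v : ℝ) : Prop where
  free : ∀ t, (∀ s ∈ Ioo 0 t, η s < y + s * v) → ∀ s ∈ Ioo 0 t, f (y + s * v) v s = φ v
  collided : ∀ τ t, 0 < τ → η τ = y + τ * v → (∀ s ∈ Ioo τ t, η s < y + s * v) →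
    ∀ s ∈ Ioo τ t, f (y + s * v) v s = 2 * Real.exp (-(v - p τ) ^ 2) * J τ

/-- Only an a.e. version `J` of the inflow is needed, since almost every trajectory avoids a null
set of collision data. Two solutions can therefore share the same `J`. -/
lemma IsRightGas.ae_isRegular {φ η p J : ℝ → ℝ} {f : ℝ → ℝ → ℝ → ℝ} (h : IsRightGas φ η p f)
    (hJ : ∀ᵐ t, 0 < t → inflow η p f t = J t) :
    ∀ᵐ z : ℝ × ℝ, IsRegular φ η p J f z.1 z.2 := by
  have hJ2 : ∀ᵐ z : ℝ × ℝ, 0 < z.1 → inflow η p f z.1 = J z.1 :=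
    Measure.quasiMeasurePreserving_fst.ae hJ
  have hgen : ∀ᵐ z : ℝ × ℝ, 0 < z.1 → z.2 ≠ p z.1 ∧ (p z.1 < z.2 →
      postTrace η f z.1 z.2 = 2 * Real.exp (-(z.2 - p z.1) ^ 2) * J z.1) := by
    filter_upwards [hJ2, h.boundary, ae_ne_velocity h.velocity_continuous] with z h1 h2 h3 h0
    exact ⟨h3 h0, fun hlt => by rw [h2 h0 hlt, h1 h0]⟩
  -- A trajectory starting at 0 meets the disk at time 0, so transport could not be used from the
  -- initial time.
  have hy : ∀ᵐ z : ℝ × ℝ, z.1 ≠ 0 :=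
    Measure.quasiMeasurePreserving_fst.ae (Measure.ae_ne volume (0 : ℝ))
  filter_upwards [h.initial, h.transport, hy, ae_trajectory_of_ae h.position_deriv hgen] with
    z hini htr hz hcol
  obtain ⟨y, v⟩ := z
  simp only at hini htr hz hcol
  refine ⟨fun t hfree s hs => ?_, fun τ t hτ hmeet hfree s hs => ?_⟩
  · have := htr 0 s le_rfl hs.1.le fun τ hτ => ?_
    · rw [← this, zero_mul, add_zero, hini]
    · rcases hτ.1.eq_or_lt with h0 | h0
      · rw [← h0, h.position_zero, zero_mul, add_zero]
        exact hz
      · exact (hfree τ ⟨h0, hτ.2.trans_lt hs.2⟩).ne'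
  · obtain ⟨hne, hpost⟩ := hcol τ hτ hmeet
    have hτt : τ < t := hs.1.trans hs.2
    have hconst : ∀ r ∈ Ioo τ t, f (y + r * v) v r = f (y + s * v) v s := by
      have aux : ∀ a ∈ Ioo τ t, ∀ b ∈ Ioo τ t, a ≤ b →
          f (y + a * v) v a = f (y + b * v) v b := fun a ha b hb hab =>
        htr a b (hτ.le.trans ha.1.le) hab fun r hr =>
          (hfree r ⟨ha.1.trans_le hr.1, hr.2.trans_lt hb.2⟩).ne'
      intro r hr
      rcases le_total r s with hrs | hrs
      · exact aux r hr s hs hrs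
      · exact (aux s hs r hr hrs).symm
    -- Staying to the right after the collision forces the particle to be no slower than the disk;
    -- genericity excludes equality, so the boundary condition applies.
    have hle : p τ ≤ v := by
      have hd : HasDerivAt (fun s => η s - s * v) (p τ - v) τ := by
        simpa using (hasDerivAt_of_position h.position_deriv hτ).fun_sub
          ((hasDerivAt_id τ).mul_const v)
      have htend := (hasDerivWithinAt_iff_tendsto_slope' (by simp)).1
        (hd.hasDerivWithinAt (s := Ioi τ))
      have : p τ - v ≤ 0 := by
        refine le_of_tendsto htend ?_
        filter_upwards [Ioo_mem_nhdsGT hτt] with r hr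
        have h1 := hfree r hr
        rw [slope_def_field]
        refine div_nonpos_of_nonpos_of_nonneg ?_ (by linarith [hr.1])
        linarith
      linarith
    have hlt : p τ < v := lt_of_le_of_ne hle (Ne.symm hne)
    rw [← hpost hlt]
    unfold postTrace
    have htend : Tendsto (fun ε => f (η τ + ε * v) v (τ + ε)) (𝓝[>] 0)
        (𝓝 (f (y + s * v) v s)) := by
      refine tendsto_const_nhds.congr' ?_
      filter_upwards [Ioo_mem_nhdsGT (show (0 : ℝ) < t - τ by linarith)] with ε hε
      have e : η τ + ε * v = y + (τ + ε) * v := by rw [hmeet]; ring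
      rw [e, hconst (τ + ε) ⟨by linarith [hε.1], by linarith [hε.2]⟩]
    exact htend.limUnder_eq.symm

/-- The restriction of `p` to `[0, T]`, continued by constants. -/
noncomputable def clamped (p : ℝ → ℝ) (T s : ℝ) : ℝ := p (max 0 (min s T))

lemma clamped_of_mem {p : ℝ → ℝ} {T s : ℝ} (hs : s ∈ Icc 0 T) : clamped p T s = p s := by
  simp [clamped, min_eq_left hs.2, max_eq_right hs.1]

/-- Clamping the time is 1-Lipschitz, so compactness of `[0, T]` yields the global bounds that the
estimates on moments require. -/
lemma exists_clamped_bounds {p : ℝ → ℝ} (hp : LocallyLipschitzOn (Ici 0) p) {T : ℝ} (hT : 0 ≤ T) :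
    ∃ (L : NNReal) (P : ℝ), LipschitzWith L (clamped p T) ∧ ∀ s, |clamped p T s| ≤ P := by
  have hmem : ∀ s, max 0 (min s T) ∈ Icc 0 T := fun s =>
    ⟨le_max_left _ _, max_le hT (min_le_right _ _)⟩
  have hloc : LocallyLipschitzOn (Icc 0 T) p := hp.mono Icc_subset_Ici_self
  obtain ⟨L, hL⟩ := hloc.exists_lipschitzOnWith_of_compact isCompact_Icc
  obtain ⟨P, hP⟩ := isCompact_Icc.exists_bound_of_continuousOn hloc.continuousOn
  refine ⟨L, P, LipschitzWith.of_dist_le_mul fun s t => ?_, fun s => hP _ (hmem s)⟩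
  refine (hL.dist_le_mul _ (hmem s) _ (hmem t)).trans ?_
  refine mul_le_mul_of_nonneg_left ?_ L.2
  rw [Real.dist_eq, Real.dist_eq]
  have h1 : |max 0 (min s T) - max 0 (min t T)| ≤ |min s T - min t T| :=
    (abs_max_sub_max_le_max 0 (min s T) 0 (min t T)).trans (by simp)
  have h2 : |min s T - min t T| ≤ |s - t| := (abs_min_sub_min_le_max s T t T).trans (by simp)
  exact h1.trans h2

/-! ### The arriving density and the integral equation for the flux -/

section Arrival

variable {φ η p J : ℝ → ℝ} {f : ℝ → ℝ → ℝ → ℝ} {B P T t v : ℝ} {L : NNReal}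

lemma integral_velocity (hη : ∀ t : ℝ, 0 ≤ t → HasDerivWithinAt η (p t) (Ici 0) t)
    (hp : ContinuousOn p (Ici 0)) {s : ℝ} (hs : 0 ≤ s) (hst : s ≤ t) :
    ∫ r in s..t, p r = η t - η s := by
  have hsub : Icc s t ⊆ Ici 0 := fun r hr => hs.trans hr.1
  refine intervalIntegral.integral_eq_sub_of_hasDerivAt_of_le hst
    ((continuousOn_of_position hη).mono hsub)
    (fun r hr => hasDerivAt_of_position hη (hs.trans_lt hr.1)) ?_
  exact ((hp.mono hsub).mono (by rw [uIcc_of_le hst])).intervalIntegrable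

lemma mul_velTo_clamped (hη : ∀ t : ℝ, 0 ≤ t → HasDerivWithinAt η (p t) (Ici 0) t)
    (hp : ContinuousOn p (Ici 0)) {s : ℝ} (hs : 0 ≤ s) (hst : s ≤ t) (htT : t ≤ T) :
    (t - s) * velTo (clamped p T) t s = η t - η s := by
  rw [velTo_of_ge _ hst, mul_meanVel, ← integral_velocity hη hp hs hst]
  refine intervalIntegral.integral_congr fun r hr => ?_
  rw [uIcc_of_le hst] at hr
  exact clamped_of_mem ⟨hs.trans hr.1, hr.2.trans htT⟩

/-- After the last hitting time the mean disk velocity up to `t` exceeds `v`, which says that the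
backward trajectory is strictly to the right of the disk. The density is constant there, so the
trace is that constant. -/
lemma IsRegular.preTrace_eq (hreg : IsRegular φ η p J f (η t - t * v) v)
    (hη : ∀ t : ℝ, 0 ≤ t → HasDerivWithinAt η (p t) (Ici 0) t)
    (hp : ContinuousOn p (Ici 0)) (hL : LipschitzWith L (clamped p T)) (ht : 0 < t)
    (htT : t ≤ T) (hv : v < p t) :
    preTrace η f t v =
      gasTrace φ (clamped p T) J (lastHit (velTo (clamped p T) t) T v) v := by
  have hv' : v < clamped p T t := by rwa [clamped_of_mem ⟨ht.le, htT⟩]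
  set τ := lastHit (velTo (clamped p T) t) T v with hτ
  have hτ0 : 0 ≤ τ := lastHit_nonneg (ht.le.trans htT)
  have hτt : τ < t := lastHit_velTo_lt hL ht htT hv'
  have hfree : ∀ s ∈ Ioo τ t, η s < η t - t * v + s * v := by
    intro s hs
    have h0 : 0 ≤ s := hτ0.trans hs.1.le
    have h1 := lt_of_lastHit_lt h0 (hs.2.le.trans htT) hs.1
    have h2 := mul_velTo_clamped (T := T) hη hp h0 hs.2.le htT
    have h3 := mul_lt_mul_of_pos_left h1 (sub_pos.2 hs.2)
    rw [h2] at h3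
    linarith
  have hval : ∀ s ∈ Ioo τ t, f (η t - t * v + s * v) v s = gasTrace φ (clamped p T) J τ v := by
    intro s hs
    unfold gasTrace
    split_ifs with hpos
    · have h1 := velTo_lastHit_eq hL htT hv' hpos
      have h2 := mul_velTo_clamped (T := T) hη hp hpos.le hτt.le htT
      rw [h1] at h2
      rw [clamped_of_mem ⟨hτ0, hτt.le.trans htT⟩]
      exact hreg.collided τ t hpos (by linarith) hfree s hs
    · have h0 : τ = 0 := le_antisymm (not_lt.1 hpos) hτ0
      rw [h0] at hfree hs
      exact hreg.free t hfree s hs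
  unfold preTrace
  refine Tendsto.limUnder_eq (tendsto_const_nhds.congr' ?_)
  filter_upwards [Ioo_mem_nhdsGT (sub_pos.2 hτt)] with ε hε
  have e : η t - ε * v = η t - t * v + (t - ε) * v := by ring
  rw [e, hval (t - ε) ⟨by linarith [hε.2], by linarith [hε.1]⟩]

lemma IsRightGas.ae_preTrace_eq (h : IsRightGas φ η p f) (hL : LipschitzWith L (clamped p T)) :
    ∀ᵐ t : ℝ, t ∈ Ioc 0 T → ∀ᵐ v : ℝ, v < p t → preTrace η f t v =
      gasTrace φ (clamped p T) (inflow η p f) (lastHit (velTo (clamped p T) t) T v) v := by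
  have h1 := h.ae_isRegular (J := inflow η p f) (ae_of_all _ fun _ _ => rfl)
  have h2 := Measure.ae_ae_of_ae_prod
    (ae_arrival_of_ae h.position_deriv h.velocity_continuous h1)
  filter_upwards [h2] with t ht htT
  filter_upwards [ht] with v hv hvp
  exact (hv htT.1 hvp.ne).preTrace_eq h.position_deriv h.velocity_continuous hL htT.1 htT.2 hvp

lemma IsRightGas.ae_integral_preTrace (h : IsRightGas φ η p f)
    (hL : LipschitzWith L (clamped p T)) (k : ℕ) :
    ∀ᵐ t : ℝ, t ∈ Ioc 0 T → ∫ v in Iio (p t), (p t - v) ^ k * preTrace η f t v =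
      moment φ (clamped p T) (inflow η p f) T k t := by
  filter_upwards [h.ae_preTrace_eq hL] with t ht htT
  unfold moment
  rw [clamped_of_mem (Ioc_subset_Icc_self htT)]
  refine setIntegral_congr_ae measurableSet_Iio ?_
  filter_upwards [ht htT] with v hv hvp
  rw [hv hvp]

/-- The second moment of `φ` at very negative velocities is not assumed: it is read off from the
finite momentum flux at one generic time, when gas slower than `-P` arrives uncollided. -/
lemma IsRightGas.isInitialDensity (h : IsRightGas φ η p f) (hφm : Measurable φ)
    (hφB : ∀ v, |φ v| ≤ B) (hφ : Integrable φ) (hT : 0 < T)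
    (hL : LipschitzWith L (clamped p T)) (hP : ∀ s, |clamped p T s| ≤ P) :
    IsInitialDensity φ B P := by
  refine ⟨hφm, hφB, ?_⟩
  have hfreq : ∃ᵐ t : ℝ, t ∈ Ioc 0 T := frequently_ae_mem_iff.2 (by simp [hT])
  obtain ⟨t, htT, ht1, ht2⟩ := (hfreq.and_eventually
    (h.momentum_integrable.and (h.ae_preTrace_eq hL))).exists
  have hpt : |p t| ≤ P := by
    have := hP t
    rwa [clamped_of_mem (Ioc_subset_Icc_self htT)] at this
  have hint : IntegrableOn (fun v => (v - p t) ^ 2 * φ v) (Iio (-P)) := by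
    refine (ht1 htT.1).integrableOn.congr ?_
    filter_upwards [ae_restrict_mem measurableSet_Iio, ae_restrict_of_ae (ht2 htT)] with v hv hvt
    have hv' : v < -P := hv
    rw [hvt (hv'.trans_le (abs_le.1 hpt).1), lastHit_eq_zero hT.le, gasTrace, if_neg (lt_irrefl _)]
    intro τ _
    exact hv'.trans_le (abs_le.1 (abs_velTo_le hL.continuous hP t τ)).1
  have hdom : IntegrableOn (fun v => 2 * |(v - p t) ^ 2 * φ v| + 2 * (1 + 2 * P) ^ 2 * |φ v|)
      (Iio (-P)) := (hint.abs.const_mul 2).add (hφ.integrableOn.abs.const_mul _)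
  refine hdom.mono' (by fun_prop) (ae_of_all _ fun v => ?_)
  rw [norm_mul, abs_mul, Real.norm_eq_abs, Real.norm_eq_abs, abs_of_nonneg (sq_nonneg (v - p t)),
    abs_of_nonneg (sq_nonneg (1 + P - v)), ← mul_assoc, ← add_mul]
  refine mul_le_mul_of_nonneg_right ?_ (abs_nonneg _)
  have h1 : (1 + P - p t) ^ 2 ≤ (1 + 2 * P) ^ 2 := by
    have := (abs_le.1 hpt).1; have := (abs_le.1 hpt).2
    gcongr <;> linarith
  nlinarith [sq_nonneg (1 + P - p t + (v - p t))]

/-- The mass flux into the disk is locally integrable: the outgoing gas which is faster than the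
disk determines the flux, and it never returns to the disk. -/
lemma IsRightGas.integrableOn_inflow (h : IsRightGas φ η p f) (T : ℝ) :
    IntegrableOn (inflow η p f) (Icc 0 T) := by
  rcases lt_or_ge T 0 with hT | hT
  · simp [Icc_eq_empty (not_le.2 hT)]
  obtain ⟨P, hP⟩ := (isCompact_Icc (a := (0 : ℝ)) (b := T + 1)).exists_bound_of_continuousOn
    (h.velocity_continuous.mono Icc_subset_Ici_self)
  obtain ⟨H, hH⟩ := (isCompact_Icc (a := (0 : ℝ)) (b := T + 1)).exists_bound_of_continuousOn
    ((continuousOn_of_position h.position_deriv).mono Icc_subset_Ici_self)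
  simp only [Real.norm_eq_abs] at hP hH
  have hP0 : 0 ≤ P := (abs_nonneg _).trans (hP 0 ⟨le_rfl, by linarith⟩)
  have hH0 : 0 ≤ H := (abs_nonneg _).trans (hH 0 ⟨le_rfl, by linarith⟩)
  set R := H + (T + 1) * (P + 2) + (P + 2) + (T + 1) with hR
  have hTP : 0 ≤ (T + 1) * (P + 2) := by positivity
  have hslice : ∀ᵐ v : ℝ, ∀ᵐ t : ℝ, v ∈ Icc (-R) R → t ∈ Icc 0 R →
      IntegrableOn (fun x => f x v t) (Icc (-R) R) := by
    have h1 := h.integrable R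
    rw [IntegrableOn, Measure.volume_eq_prod, ← Measure.prod_restrict] at h1
    have h2 := h1.prod_left_ae
    rw [ae_restrict_iff' (measurableSet_Icc.prod measurableSet_Icc)] at h2
    filter_upwards [Measure.ae_ae_of_ae_prod h2] with v hv
    filter_upwards [hv] with t ht hvR htR
    exact ht ⟨hvR, htR⟩
  have hreg : ∀ᵐ v : ℝ, ∀ᵐ y : ℝ, IsRegular φ η p (inflow η p f) f y v := by
    have h1 := h.ae_isRegular (J := inflow η p f) (ae_of_all _ fun _ _ => rfl)
    have h2 : ∀ᵐ z : ℝ × ℝ, IsRegular φ η p (inflow η p f) f z.2 z.1 :=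
      Measure.measurePreserving_swap.quasiMeasurePreserving.ae h1
    exact Measure.ae_ae_of_ae_prod h2
  -- At such a velocity outgoing gas outruns the disk up to time `T + 1`. One generic time slice
  -- after `T` therefore records the flux at all collision times in `(0, T)`.
  have hfv : ∃ᵐ v : ℝ, v ∈ Icc (P + 1) (P + 2) := frequently_ae_mem_iff.2 (by simp)
  obtain ⟨v, hv, hvs, hvr⟩ := (hfv.and_eventually (hslice.and hreg)).exists
  have hft : ∃ᵐ t : ℝ, t ∈ Ioo T (T + 1) := frequently_ae_mem_iff.2 (by simp)
  obtain ⟨t, ht, hts⟩ := (hft.and_eventually hvs).exists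
  have ht0 : 0 < t := hT.trans_lt ht.1
  have hv0 : 0 ≤ v := by linarith [hv.1]
  have hint := hts ⟨by linarith [hv.1], by linarith [hv.2]⟩ ⟨ht0.le, by linarith [ht.2]⟩
  set g : ℝ → ℝ := fun τ => η τ - τ * v with hg
  have hgd : ∀ τ, 0 < τ → HasDerivAt g (p τ - v) τ := fun τ hτ => by
    simpa using (hasDerivAt_of_position h.position_deriv hτ).fun_sub
      ((hasDerivAt_id τ).mul_const v)
  have hgc : ContinuousOn g (Icc 0 (T + 1)) :=
    ((continuousOn_of_position h.position_deriv).mono Icc_subset_Ici_self).sub (by fun_prop)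
  have hanti : StrictAntiOn g (Icc 0 (T + 1)) := by
    refine strictAntiOn_of_deriv_neg (convex_Icc _ _) hgc fun τ hτ => ?_
    rw [interior_Icc] at hτ
    rw [(hgd τ hτ.1).deriv]
    linarith [(abs_le.1 (hP τ (Ioo_subset_Icc_self hτ))).2, hv.1]
  have hsub : Ioo 0 T ⊆ Icc 0 (T + 1) := fun τ hτ => ⟨hτ.1.le, by linarith [hτ.2]⟩
  have hF : IntegrableOn (fun y => f (y + t * v) v t) (g '' Ioo 0 T) := by
    have h1 := ((integrable_indicator_iff measurableSet_Icc).2 hint).comp_add_right (t * v)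
    refine h1.integrableOn.congr_fun_ae ?_
    have hm : MeasurableSet (g '' Ioo 0 T) :=
      measurableSet_Ioo.image_of_continuousOn_injOn (hgc.mono hsub) (hanti.injOn.mono hsub)
    filter_upwards [ae_restrict_mem hm] with y hy
    obtain ⟨τ, hτ, rfl⟩ := hy
    refine indicator_of_mem (mem_Icc.2 (abs_le.1 (?_ : |g τ + t * v| ≤ R))) _
    have e : g τ + t * v = η τ + (t - τ) * v := by simp only [hg]; ring
    have h2 : (t - τ) * v ≤ (T + 1) * (P + 2) :=
      mul_le_mul (by linarith [hτ.1, ht.2]) hv.2 hv0 (by linarith)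
    have h3 : 0 ≤ (t - τ) * v := mul_nonneg (by linarith [hτ.2, ht.1]) hv0
    rw [e]
    refine (abs_add_le _ _).trans ?_
    rw [abs_of_nonneg h3]
    linarith [hH τ (hsub hτ)]
  have hpull := (integrableOn_image_iff_integrableOn_abs_deriv_smul measurableSet_Ioo
    (fun τ hτ => (hgd τ hτ.1).hasDerivWithinAt) (hanti.injOn.mono hsub) _).1 hF
  have hregτ : ∀ᵐ τ : ℝ, τ ∈ Ioo 0 T → IsRegular φ η p (inflow η p f) f (g τ) v := by
    set g' : ℝ → ℝ := fun τ => η (max 0 τ) - τ * v with hg'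
    have e : ∀ τ, 0 ≤ τ → g' τ = g τ := fun τ hτ => by simp [hg', hg, max_eq_right hτ]
    have hc : Continuous g' :=
      ((continuousOn_of_position h.position_deriv).comp_continuous (by fun_prop)
        fun t => mem_Ici.2 (le_max_left (0 : ℝ) t)).sub (continuous_id.mul continuous_const)
    filter_upwards [ae_of_ae_deriv_ne_zero hc (g' := fun τ => p τ - v)
      (fun τ hτ => (hgd τ hτ).congr_of_eventuallyEq (by
        filter_upwards [Ioi_mem_nhds hτ] with s hs using e s (mem_Ioi.1 hs).le))
      ((h.velocity_continuous.mono Ioi_subset_Ici_self).sub continuousOn_const) hvr] with τ hτ hτT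
    rw [← e τ hτT.1.le]
    refine hτ hτT.1 ?_
    linarith [(abs_le.1 (hP τ (hsub hτT))).2, hv.1]
  -- The prefactor inverts the Gaussian of the boundary condition and the Jacobian `v - p τ ≥ 1`, so
  -- the expression is the inflow itself.
  have hJ : IntegrableOn (fun τ => Real.exp ((v - p τ) ^ 2) / (2 * (v - p τ)) *
      (|p τ - v| • f (g τ + t * v) v t)) (Ioo 0 T) := by
    have hlow : ∀ τ ∈ Ioo 0 T, 1 ≤ v - p τ ∧ v - p τ ≤ 2 * P + 2 := fun τ hτ => by
      have := abs_le.1 (hP τ (hsub hτ))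
      exact ⟨by linarith [hv.1], by linarith [hv.2]⟩
    refine Integrable.bdd_mul (c := Real.exp ((2 * P + 2) ^ 2)) hpull ?_ ?_
    · refine ContinuousOn.aestronglyMeasurable ?_ measurableSet_Ioo
      have hpc : ContinuousOn p (Ioo 0 T) :=
        h.velocity_continuous.mono (fun τ hτ => mem_Ici.2 hτ.1.le)
      have hvp : ContinuousOn (fun τ => v - p τ) (Ioo 0 T) := continuousOn_const.sub hpc
      refine (hvp.pow 2).rexp.div (continuousOn_const.mul hvp) fun τ hτ => ?_
      have := (hlow τ hτ).1
      positivity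
    · filter_upwards [ae_restrict_mem measurableSet_Ioo] with τ hτ
      obtain ⟨h1, h2⟩ := hlow τ hτ
      rw [Real.norm_eq_abs, abs_of_nonneg (by positivity), div_le_iff₀ (by positivity)]
      have h3 : Real.exp ((v - p τ) ^ 2) ≤ Real.exp ((2 * P + 2) ^ 2) :=
        Real.exp_le_exp.2 (by gcongr)
      nlinarith [Real.exp_pos ((2 * P + 2) ^ 2)]
  rw [integrableOn_Icc_iff_integrableOn_Ioo]
  refine hJ.congr ?_
  filter_upwards [ae_restrict_mem measurableSet_Ioo, ae_restrict_of_ae hregτ] with τ hτ hr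
  have hval := (hr hτ).collided τ (T + 1) hτ.1 (by simp [hg]) (fun s hs => ?_) t
    ⟨hτ.2.trans ht.1, ht.2⟩
  · have hpos : 0 < v - p τ := by
      linarith [(abs_le.1 (hP τ (hsub hτ))).2, hv.1]
    rw [hval, abs_sub_comm, abs_of_pos hpos, smul_eq_mul, Real.exp_neg]
    field_simp
  · have := hanti (hsub hτ) ⟨hτ.1.le.trans hs.1.le, hs.2.le⟩ hs.1
    simp only [hg] at this ⊢
    linarith

/-- The mass flux into the disk from the right solves an integral equation. -/
lemma IsRightGas.exists_flow (h : IsRightGas φ η p f) (hφ : IsInitialDensity φ B P)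
    (hL : LipschitzWith L (clamped p T)) (hP : ∀ s, |clamped p T s| ≤ P) :
    ∃ J Q, IsFlow L P Q T (clamped p T) J ∧
      (∀ t ∈ Icc 0 T, J t = moment φ (clamped p T) J T 1 t) ∧
      (∀ᵐ t : ℝ, t ∈ Ioc 0 T → inflow η p f t = J t) ∧
      ∀ᵐ t : ℝ, t ∈ Ioc 0 T → ∫ v in Iio (p t), (p t - v) ^ 2 * preTrace η f t v =
        moment φ (clamped p T) J T 2 t := by
  have hint := h.integrableOn_inflow T
  obtain ⟨Q, hQ⟩ := exists_abs_moment_le (k := 1) hφ hL hP (Or.inl rfl) hint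
  -- The inflow is replaced by its own moment, which equals it a.e. Moments see only the a.e. class,
  -- so the integral equation now holds at every time.
  set J := moment φ (clamped p T) (inflow η p f) T 1 with hJ
  have hae : ∀ᵐ t : ℝ, t ∈ Ioc 0 T → inflow η p f t = J t := by
    filter_upwards [h.ae_integral_preTrace hL 1] with t ht htT
    rw [hJ, ← ht htT]
    simp [inflow]
  have hae' : ∀ᵐ t ∂volume.restrict (Icc 0 T), inflow η p f t = J t := by
    rw [← Measure.restrict_congr_set Ioc_ae_eq_Icc, ae_restrict_iff' measurableSet_Ioc]
    exact hae
  refine ⟨J, Q, ⟨hL, hP, hint.congr hae', hQ⟩, fun t ht => ?_, hae, ?_⟩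
  · exact moment_congr hL ht.1 ht.2 hae'
  · filter_upwards [h.ae_integral_preTrace hL 2] with t ht htT
    rw [ht htT, moment_congr hL htT.1.le htT.2 hae']

end Arrival

/-! ### Reflection -/

/-- The gas density seen in the mirror. -/
def reflect (f : ℝ → ℝ → ℝ → ℝ) (x v t : ℝ) : ℝ := f (-x) (-v) t

section Reflection

variable {η p : ℝ → ℝ} {f : ℝ → ℝ → ℝ → ℝ}

lemma preTrace_reflect (t v : ℝ) : preTrace (-η) (reflect f) t v = preTrace η f t (-v) := by
  unfold preTrace reflect
  congr 1
  ext ε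
  congr 1
  simp only [Pi.neg_apply]
  ring

lemma postTrace_reflect (t v : ℝ) : postTrace (-η) (reflect f) t v = postTrace η f t (-v) := by
  unfold postTrace reflect
  congr 1
  ext ε
  congr 1
  simp only [Pi.neg_apply]
  ring

lemma integral_Iio_neg (g : ℝ → ℝ) (c : ℝ) : ∫ v in Iio (-c), g (-v) = ∫ v in Ioi c, g v := by
  rw [← integral_Iic_eq_integral_Iio, integral_comp_neg_Iic, neg_neg]

lemma integral_Ioi_neg (g : ℝ → ℝ) (c : ℝ) : ∫ v in Ioi (-c), g (-v) = ∫ v in Iio c, g v := by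
  rw [integral_comp_neg_Ioi, neg_neg, integral_Iic_eq_integral_Iio]

lemma inflow_reflect (t : ℝ) : inflow (-η) (-p) (reflect f) t =
    ∫ w in Ioi (p t), (w - p t) * preTrace η f t w := by
  rw [← integral_Iio_neg]
  unfold inflow
  simp only [preTrace_reflect, Pi.neg_apply]
  congr 1
  ext w
  ring

lemma dragR_reflect (t : ℝ) : dragR (-η) (-p) (reflect f) t = dragL η p f t := by
  unfold dragL dragR
  rw [← integral_Iio_neg fun v => (v - p t) ^ 2 * preTrace η f t v,
    ← integral_Ioi_neg fun v => (p t - v) ^ 2 * postTrace η f t v, add_comm]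
  simp only [preTrace_reflect, postTrace_reflect, Pi.neg_apply]
  congr 2
  · ext w
    ring
  · ext w
    ring

end Reflection

section Solution

variable {φ₀ φ : ℝ → ℝ} {F : ℝ → ℝ → ℝ} {p₀ : ℝ} {η p : ℝ → ℝ} {f : ℝ → ℝ → ℝ → ℝ}

lemma IsSolution.isRightGas (h : IsSolution φ₀ F p₀ η p f) (hφ : φ₀ =ᵐ[volume] φ) :
    IsRightGas φ η p f where
  integrable := h.integrable
  initial := by
    have hφ2 : ∀ᵐ z : ℝ × ℝ, φ₀ z.2 = φ z.2 := Measure.quasiMeasurePreserving_snd.ae hφ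
    filter_upwards [h.initial, hφ2] with z h1 h2
    rw [h1, h2]
  transport := h.transport
  momentum_integrable := h.momentum_integrable
  boundary := h.boundaryR
  position_zero := h.position_zero
  position_deriv := h.position_deriv
  velocity_continuous := h.velocity_lipschitz.continuousOn

/-- The mirror turns gas on the left into gas on the right, so every one-sided estimate also covers
`dragL`. -/
lemma IsSolution.isRightGas_reflect (h : IsSolution φ₀ F p₀ η p f) (hφ : φ₀ =ᵐ[volume] φ) :
    IsRightGas (fun v => φ (-v)) (-η) (-p) (reflect f) where
  integrable R := by
    set e : ℝ × ℝ × ℝ ≃ᵐ ℝ × ℝ × ℝ := (MeasurableEquiv.neg ℝ).prodCongr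
      ((MeasurableEquiv.neg ℝ).prodCongr (MeasurableEquiv.refl ℝ))
    have he : MeasurePreserving e volume volume :=
      (Measure.measurePreserving_neg (volume : Measure ℝ)).prod
        ((Measure.measurePreserving_neg (volume : Measure ℝ)).prod (MeasurePreserving.id volume))
    have h1 := (he.integrableOn_comp_preimage e.measurableEmbedding).2 (h.integrable R)
    have h2 : e ⁻¹' (Icc (-R) R ×ˢ Icc (-R) R ×ˢ Icc 0 R) =
        Icc (-R) R ×ˢ Icc (-R) R ×ˢ Icc 0 R := by
      ext ⟨x, v, t⟩
      change ((-x) ∈ Icc (-R) R ∧ (-v) ∈ Icc (-R) R ∧ t ∈ Icc 0 R) ↔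
        (x ∈ Icc (-R) R ∧ v ∈ Icc (-R) R ∧ t ∈ Icc 0 R)
      simp only [mem_Icc]
      constructor
      · rintro ⟨⟨_, _⟩, ⟨_, _⟩, h⟩
        exact ⟨⟨by linarith, by linarith⟩, ⟨by linarith, by linarith⟩, h⟩
      · rintro ⟨⟨_, _⟩, ⟨_, _⟩, h⟩
        exact ⟨⟨by linarith, by linarith⟩, ⟨by linarith, by linarith⟩, h⟩
    rw [h2] at h1
    exact h1
  initial := by
    have hφ2 : ∀ᵐ z : ℝ × ℝ, φ₀ z.2 = φ z.2 := Measure.quasiMeasurePreserving_snd.ae hφ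
    filter_upwards [(Measure.measurePreserving_neg
      (volume : Measure (ℝ × ℝ))).quasiMeasurePreserving.ae (h.initial.and hφ2)] with z hz
    exact hz.1.trans hz.2
  transport := by
    filter_upwards [(Measure.measurePreserving_neg
      (volume : Measure (ℝ × ℝ))).quasiMeasurePreserving.ae h.transport] with z hz s t hs hst hτ
    have := hz s t hs hst fun τ hτm hcon => hτ τ hτm (by
      simp only [Prod.fst_neg, Prod.snd_neg] at hcon
      rw [Pi.neg_apply, ← hcon]
      ring)
    simp only [Prod.fst_neg, Prod.snd_neg, mul_neg] at this
    unfold reflect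
    rw [neg_add, neg_add]
    exact this
  momentum_integrable := by
    filter_upwards [h.momentum_integrable] with t ht h0
    refine (ht h0).comp_neg.congr (ae_of_all _ fun v => ?_)
    simp only [preTrace_reflect, Pi.neg_apply]
    ring
  boundary := by
    have hmp : MeasurePreserving (Prod.map id Neg.neg : ℝ × ℝ → ℝ × ℝ) volume volume :=
      (MeasurePreserving.id volume).prod (Measure.measurePreserving_neg (volume : Measure ℝ))
    filter_upwards [hmp.quasiMeasurePreserving.ae h.boundaryL] with z hz h0 hlt
    have := hz h0 (by simp only [Prod.map_fst, Prod.map_snd, id, Pi.neg_apply] at hlt ⊢; linarith)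
    rw [inflow_reflect, postTrace_reflect]
    simp only [Prod.map_fst, Prod.map_snd, id] at this
    rw [this, Pi.neg_apply]
    congr 4
    ring
  position_zero := by simp [h.position_zero]
  position_deriv t ht := (h.position_deriv t ht).neg
  velocity_continuous := h.velocity_lipschitz.continuousOn.neg

end Solution

/-! ### Stability of the drag -/

/-- The momentum carried away per unit of mass flux by the outgoing gas. -/
noncomputable def recoil : ℝ := ∫ u in Ioi (0 : ℝ), u ^ 2 * (2 * Real.exp (-u ^ 2))

section Stability

variable {φ η p η₁ p₁ η₂ p₂ : ℝ → ℝ} {f f₁ f₂ : ℝ → ℝ → ℝ → ℝ} {B P T : ℝ} {L : NNReal}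

/-- In the frame of the disk the outgoing profile is a fixed Gaussian; its momentum is proportional
to the inflow. -/
lemma IsRightGas.ae_dragR_eq (h : IsRightGas φ η p f) : ∀ᵐ t : ℝ, 0 < t → dragR η p f t =
    (∫ v in Iio (p t), (p t - v) ^ 2 * preTrace η f t v) + recoil * inflow η p f t := by
  filter_upwards [Measure.ae_ae_of_ae_prod h.boundary] with t ht h0
  unfold dragR recoil
  congr 1
  rw [← integral_mul_const]
  have e : ∫ v in Ioi (p t), (v - p t) ^ 2 * postTrace η f t v =
      ∫ v in Ioi (p t), (v - p t) ^ 2 * (2 * Real.exp (-(v - p t) ^ 2)) * inflow η p f t := by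
    refine setIntegral_congr_ae measurableSet_Ioi ?_
    filter_upwards [ht] with v hv hvp
    rw [hv h0 hvp]
    ring
  rw [e]
  have hshift := (measurePreserving_sub_right volume (p t)).setIntegral_preimage_emb
    (measurableEmbedding_subRight (p t))
    (fun u : ℝ => u ^ 2 * (2 * Real.exp (-u ^ 2)) * inflow η p f t) (Ioi 0)
  rw [← hshift]
  congr 2
  ext v
  simp

lemma IsFlow.mono {Q Q' : ℝ} {J : ℝ → ℝ} (h : IsFlow L P Q T p J)
    (hQ : Q ≤ Q') : IsFlow L P Q' T p J :=
  ⟨h.lipschitz, h.abs_le, h.integrableOn, fun s hs => (h.abs_flux_le s hs).trans hQ⟩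

/-- The mass flux and the drag are controlled by the velocity of the disk. -/
lemma exists_drag_stability (h₁ : IsRightGas φ η₁ p₁ f₁) (h₂ : IsRightGas φ η₂ p₂ f₂)
    (hφ : IsInitialDensity φ B P) (hT : 0 ≤ T)
    (hL₁ : LipschitzWith L (clamped p₁ T)) (hP₁ : ∀ s, |clamped p₁ T s| ≤ P)
    (hL₂ : LipschitzWith L (clamped p₂ T)) (hP₂ : ∀ s, |clamped p₂ T s| ≤ P) :
    ∃ C, 0 < C ∧ ∀ l ≥ C, ∀ D ≥ 0, (∀ t ∈ Icc 0 T, |p₁ t - p₂ t| ≤ D * Real.exp (l * t)) →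
      ∀ᵐ t : ℝ, t ∈ Ioc 0 T →
        |inflow η₁ p₁ f₁ t - inflow η₂ p₂ f₂ t| ≤ C * D * Real.exp (l * t) ∧
        |dragR η₁ p₁ f₁ t - dragR η₂ p₂ f₂ t| ≤ C * D * Real.exp (l * t) := by
  obtain ⟨J₁, Q₁, hf₁, hJ₁, hi₁, hm₁⟩ := h₁.exists_flow hφ hL₁ hP₁
  obtain ⟨J₂, Q₂, hf₂, hJ₂, hi₂, hm₂⟩ := h₂.exists_flow hφ hL₂ hP₂
  obtain ⟨C, hC, hstab⟩ := exists_moment_stability hφ hT (hf₁.mono (le_max_left Q₁ Q₂))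
    (hf₂.mono (le_max_right Q₁ Q₂)) hJ₁ hJ₂
  refine ⟨(1 + |recoil|) * C, by positivity, fun l hl D hD hp => ?_⟩
  have hCl : C ≤ (1 + |recoil|) * C := by
    have := mul_nonneg (abs_nonneg recoil) hC.le
    linarith
  have hp' : ∀ t ∈ Icc 0 T, |clamped p₁ T t - clamped p₂ T t| ≤ D * Real.exp (l * t) :=
    fun t ht => by rw [clamped_of_mem ht, clamped_of_mem ht]; exact hp t ht
  have hs := hstab l (hCl.trans hl) D hD hp'
  filter_upwards [hi₁, hi₂, hm₁, hm₂, h₁.ae_dragR_eq, h₂.ae_dragR_eq] with t i₁ i₂ m₁ m₂ d₁ d₂ ht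
  have ht' := Ioc_subset_Icc_self ht
  have s1 := hs 1 (Or.inl rfl) t ht'
  have s2 := hs 2 (Or.inr rfl) t ht'
  rw [← hJ₁ t ht', ← hJ₂ t ht', ← i₁ ht, ← i₂ ht] at s1
  rw [← m₁ ht, ← m₂ ht] at s2
  have hE : 0 ≤ |recoil| * (C * D * Real.exp (l * t)) := by positivity
  refine ⟨by linarith, ?_⟩
  rw [d₁ ht.1, d₂ ht.1, add_sub_add_comm, ← mul_sub]
  refine (abs_add_le _ _).trans ?_
  rw [abs_mul]
  have := mul_le_mul_of_nonneg_left s1 (abs_nonneg recoil)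
  linarith

/-- To the right of the disk, the gas density is determined by the motion of the disk and by the
mass flux into the disk. -/
lemma ae_density_eq (h₁ : IsRightGas φ η₁ p₁ f₁) (h₂ : IsRightGas φ η₂ p₂ f₂)
    (hη : ∀ t, 0 ≤ t → η₁ t = η₂ t) (hp : ∀ t, 0 ≤ t → p₁ t = p₂ t)
    (hJ : ∀ᵐ t : ℝ, 0 < t → inflow η₂ p₂ f₂ t = inflow η₁ p₁ f₁ t) {t : ℝ} (ht : 0 < t) :
    ∀ᵐ z : ℝ × ℝ, η₁ t < z.1 → f₁ z.1 z.2 t = f₂ z.1 z.2 t := by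
  set J := inflow η₁ p₁ f₁ with hJdef
  have hreg : ∀ᵐ z : ℝ × ℝ, IsRegular φ η₁ p₁ J f₁ z.1 z.2 ∧ IsRegular φ η₂ p₂ J f₂ z.1 z.2 :=
    (h₁.ae_isRegular (ae_of_all _ fun _ _ => rfl)).and (h₂.ae_isRegular hJ)
  have himg : volume ((fun z : ℝ × ℝ => (z.1 + t * z.2, z.2)) '' {z | ¬ (
      IsRegular φ η₁ p₁ J f₁ z.1 z.2 ∧ IsRegular φ η₂ p₂ J f₂ z.1 z.2)}) = 0 :=
    addHaar_image_eq_zero_of_differentiableOn_of_addHaar_eq_zero volume (by fun_prop) hreg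
  filter_upwards [measure_eq_zero_iff_ae_notMem.1 himg] with z hz hzt
  obtain ⟨x, v⟩ := z
  simp only at hzt ⊢
  obtain ⟨r₁, r₂⟩ : IsRegular φ η₁ p₁ J f₁ (x - t * v) v ∧ IsRegular φ η₂ p₂ J f₂ (x - t * v) v := by
    by_contra hcon
    exact hz ⟨(x - t * v, v), hcon, by simp⟩
  -- `U` is the signed distance to the disk; its last nonpositive time before `t` is the last
  -- collision, if there was one.
  set U : ℝ → ℝ := fun s => x - t * v + s * v - η₁ (max 0 s) with hU
  have hUc : Continuous U :=
    (by fun_prop : Continuous fun s => x - t * v + s * v).sub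
      ((continuousOn_of_position h₁.position_deriv).comp_continuous (by fun_prop)
        fun s => mem_Ici.2 (le_max_left (0 : ℝ) s))
  have hUt : 0 < U t := by simp only [hU, max_eq_right ht.le]; linarith
  -- Regularity speaks of open time intervals, so the trajectory is followed slightly beyond `t` to
  -- include `t` itself.
  obtain ⟨ε, hε, hball⟩ := Metric.mem_nhds_iff.1
    (hUc.continuousAt.eventually_const_lt hUt)
  rw [Real.ball_eq_Ioo] at hball
  set τ := lastHit U t 0 with hτ
  have hτ0 : 0 ≤ τ := lastHit_nonneg ht.le
  have hτt : τ < t := by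
    refine lt_of_le_of_ne (lastHit_le ht.le) fun heq => ?_
    have := apply_lastHit_le hUc (show 0 < lastHit U t 0 by rw [← hτ, heq]; exact ht)
    rw [← hτ, heq] at this
    linarith
  have hfree : ∀ s ∈ Ioo τ (t + ε), η₁ s < x - t * v + s * v := by
    intro s hs
    have h0 : 0 < U s := by
      rcases le_or_gt s t with hst | hst
      · exact lt_of_lastHit_lt (hτ0.trans hs.1.le) hst hs.1
      · exact hball ⟨by linarith, hs.2⟩
    simp only [hU, max_eq_right (hτ0.trans hs.1.le)] at h0
    linarith
  have hfree₂ : ∀ s ∈ Ioo τ (t + ε), η₂ s < x - t * v + s * v := fun s hs => by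
    rw [← hη s (hτ0.trans hs.1.le)]; exact hfree s hs
  have htm : t ∈ Ioo τ (t + ε) := ⟨hτt, by linarith⟩
  have ex : x - t * v + t * v = x := by ring
  rcases hτ0.eq_or_lt with h0 | hpos
  · rw [← h0] at hfree hfree₂ htm
    have e1 := r₁.free _ hfree t htm
    have e2 := r₂.free _ hfree₂ t htm
    rw [ex] at e1 e2
    rw [e1, e2]
  · have hhit : η₁ τ = x - t * v + τ * v := by
      have := apply_lastHit_eq hUc hpos hUt
      rw [← hτ] at this
      simp only [hU, max_eq_right hτ0] at this
      linarith
    have e1 := r₁.collided τ _ hpos hhit hfree t htm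
    have e2 := r₂.collided τ _ hpos (by rw [← hη τ hτ0, hhit]) hfree₂ t htm
    rw [ex] at e1 e2
    rw [e1, e2, hp τ hτ0]

end Stability

/-! ### Uniqueness -/

/-- A measurable version is set to 0 where it exceeds the essential supremum, which provides the
pointwise bound used along individual trajectories. -/
lemma exists_bounded_representative {φ₀ : ℝ → ℝ} (h₁ : MemLp φ₀ 1 volume)
    (h₂ : MemLp φ₀ ⊤ volume) :
    ∃ (φ : ℝ → ℝ) (B : ℝ), Measurable φ ∧ (∀ v, |φ v| ≤ B) ∧ Integrable φ ∧
      φ₀ =ᵐ[volume] φ := by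
  obtain ⟨g, hg, hgae⟩ := h₁.aestronglyMeasurable
  set B := (eLpNormEssSup φ₀ volume).toReal with hB
  have hfin : eLpNormEssSup φ₀ volume ≠ ⊤ := by
    have := h₂.eLpNorm_ne_top
    rwa [eLpNorm_exponent_top] at this
  have hbd : ∀ᵐ v, |φ₀ v| ≤ B := by
    filter_upwards [enorm_ae_le_eLpNormEssSup φ₀ volume] with v hv
    have := ENNReal.toReal_mono hfin hv
    simpa using this
  have hS : MeasurableSet {v | |g v| ≤ B} :=
    measurableSet_le (by simpa using hg.measurable.norm) measurable_const
  have hae : φ₀ =ᵐ[volume] {v | |g v| ≤ B}.indicator g := by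
    filter_upwards [hgae, hbd] with v h1 h2
    rw [indicator_of_mem, h1]
    change |g v| ≤ B
    rwa [← h1]
  refine ⟨{v | |g v| ≤ B}.indicator g, B, hg.measurable.indicator hS, fun v => ?_,
    (memLp_one_iff_integrable.1 h₁).congr hae, hae⟩
  by_cases hv : v ∈ {v | |g v| ≤ B}
  · rw [indicator_of_mem hv]; exact hv
  · rw [indicator_of_notMem hv, abs_zero]; exact ENNReal.toReal_nonneg

/-- Grönwall's inequality with exponential weights. -/
lemma abs_le_of_deriv_le {g : ℝ → ℝ} {L : NNReal} {T l K : ℝ} (hg : LipschitzWith L g)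
    (h0 : g 0 = 0) (hl : 0 < l) (hK : 0 ≤ K)
    (hd : ∀ᵐ t : ℝ, t ∈ Ioo 0 T → |deriv g t| ≤ K * Real.exp (l * t)) {t : ℝ} (ht : t ∈ Icc 0 T) :
    |g t| ≤ K * (Real.exp (l * t) / l) := by
  have hac : AbsolutelyContinuousOnInterval g 0 t :=
    hg.lipschitzOnWith.absolutelyContinuousOnInterval
  have hint := hac.integral_deriv_eq_sub
  rw [h0, sub_zero] at hint
  rw [← hint]
  have hb : IntervalIntegrable (fun s => K * Real.exp (l * s)) volume 0 t :=
    (by fun_prop : Continuous fun s => K * Real.exp (l * s)).intervalIntegrable _ _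
  have hle := intervalIntegral.norm_integral_le_of_norm_le (f := deriv g) ht.1 (by
    have hT : ∀ᵐ s : ℝ, s ≠ T := Measure.ae_ne volume T
    filter_upwards [hd, hT] with s hs hsT hst
    exact hs ⟨hst.1, lt_of_le_of_ne (hst.2.trans ht.2) hsT⟩) hb
  refine hle.trans ?_
  rw [intervalIntegral.integral_const_mul, intervalIntegral.integral_of_le ht.1,
    ← integral_Icc_eq_integral_Ioc]
  exact mul_le_mul_of_nonneg_left (integral_Icc_exp_le hl ht.1) hK

section Uniqueness

variable {φ₀ φ : ℝ → ℝ} {F : ℝ → ℝ → ℝ} {p₀ : ℝ} {η₁ p₁ η₂ p₂ : ℝ → ℝ}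
  {f₁ f₂ : ℝ → ℝ → ℝ → ℝ} {B T : ℝ}

lemma abs_position_sub_le (h₁ : IsSolution φ₀ F p₀ η₁ p₁ f₁) (h₂ : IsSolution φ₀ F p₀ η₂ p₂ f₂)
    {l D : ℝ} (hl : 0 < l) (hD : 0 ≤ D)
    (hp : ∀ t ∈ Icc 0 T, |p₁ t - p₂ t| ≤ D * Real.exp (l * t)) {t : ℝ} (ht : t ∈ Icc 0 T) :
    |η₁ t - η₂ t| ≤ D * (Real.exp (l * t) / l) := by
  have c₁ := h₁.velocity_lipschitz.continuousOn
  have c₂ := h₂.velocity_lipschitz.continuousOn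
  have e₁ := integral_velocity h₁.position_deriv c₁ le_rfl ht.1
  have e₂ := integral_velocity h₂.position_deriv c₂ le_rfl ht.1
  rw [h₁.position_zero, sub_zero] at e₁
  rw [h₂.position_zero, sub_zero] at e₂
  have hsub : uIcc 0 t ⊆ Ici 0 := by rw [uIcc_of_le ht.1]; exact Icc_subset_Ici_self
  rw [← e₁, ← e₂, ← intervalIntegral.integral_sub (c₁.mono hsub).intervalIntegrable
    (c₂.mono hsub).intervalIntegrable]
  have hb : IntervalIntegrable (fun s => D * Real.exp (l * s)) volume 0 t :=
    (by fun_prop : Continuous fun s => D * Real.exp (l * s)).intervalIntegrable _ _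
  have hle := intervalIntegral.norm_integral_le_of_norm_le (f := fun s => p₁ s - p₂ s) ht.1
    (ae_of_all _ fun s hs => hp s ⟨hs.1.le, hs.2.trans ht.2⟩) hb
  refine hle.trans ?_
  rw [intervalIntegral.integral_const_mul, intervalIntegral.integral_of_le ht.1,
    ← integral_Icc_eq_integral_Ioc]
  exact mul_le_mul_of_nonneg_left (integral_Icc_exp_le hl ht.1) hD

/-- Uniqueness of the velocity of the disk and of the mass fluxes on `[0, T]`. -/
lemma velocity_unique (hφm : Measurable φ) (hφB : ∀ v, |φ v| ≤ B) (hφi : Integrable φ)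
    (hφ : φ₀ =ᵐ[volume] φ) (hF : ∃ L : NNReal, ∀ t : ℝ, 0 ≤ t → LipschitzWith L (fun x => F x t))
    (h₁ : IsSolution φ₀ F p₀ η₁ p₁ f₁) (h₂ : IsSolution φ₀ F p₀ η₂ p₂ f₂) (hT : 0 < T) :
    (∀ t ∈ Icc 0 T, p₁ t = p₂ t) ∧
    ∀ᵐ t : ℝ, t ∈ Ioc 0 T → inflow η₂ p₂ f₂ t = inflow η₁ p₁ f₁ t ∧
      inflow (-η₂) (-p₂) (reflect f₂) t = inflow (-η₁) (-p₁) (reflect f₁) t := by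
  obtain ⟨L₁, P₁, hL₁, hP₁⟩ := exists_clamped_bounds h₁.velocity_lipschitz hT.le
  obtain ⟨L₂, P₂, hL₂, hP₂⟩ := exists_clamped_bounds h₂.velocity_lipschitz hT.le
  obtain ⟨LF, hLF⟩ := hF
  set L := max L₁ L₂
  set P := max P₁ P₂
  replace hL₁ : LipschitzWith L (clamped p₁ T) := hL₁.weaken (le_max_left _ _)
  replace hL₂ : LipschitzWith L (clamped p₂ T) := hL₂.weaken (le_max_right _ _)
  replace hP₁ : ∀ s, |clamped p₁ T s| ≤ P := fun s => (hP₁ s).trans (le_max_left _ _)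
  replace hP₂ : ∀ s, |clamped p₂ T s| ≤ P := fun s => (hP₂ s).trans (le_max_right _ _)
  have hL₁' : LipschitzWith L (clamped (-p₁) T) := hL₁.neg
  have hL₂' : LipschitzWith L (clamped (-p₂) T) := hL₂.neg
  have hP₁' : ∀ s, |clamped (-p₁) T s| ≤ P := fun s => (abs_neg _).trans_le (hP₁ s)
  have hP₂' : ∀ s, |clamped (-p₂) T s| ≤ P := fun s => (abs_neg _).trans_le (hP₂ s)
  have hr₁ := h₁.isRightGas hφ
  have hr₂ := h₂.isRightGas hφ
  have hl₁ := h₁.isRightGas_reflect hφ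
  have hl₂ := h₂.isRightGas_reflect hφ
  obtain ⟨CR, hCR, hR⟩ := exists_drag_stability hr₁ hr₂
    (hr₁.isInitialDensity hφm hφB hφi hT hL₁ hP₁) hT.le hL₁ hP₁ hL₂ hP₂
  obtain ⟨CL, hCL, hLe⟩ := exists_drag_stability hl₁ hl₂
    (hl₁.isInitialDensity (hφm.comp measurable_neg) (fun v => hφB (-v)) hφi.comp_neg hT hL₁' hP₁')
    hT.le hL₁' hP₁' hL₂' hP₂'
  set K := LF + (CR + CL) with hK
  have hK0 : 0 < K := by positivity
  -- Integrating the derivative bound gains `K / l ≤ 1 / 2`; the weighted supremum `D` then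
  -- satisfies `D ≤ D / 2` and vanishes.
  set l := 2 * K + 1 with hl
  have hl1 : 1 ≤ l := by linarith
  have hl0 : 0 < l := by linarith
  have hlR : CR ≤ l := by have := LF.2; change 0 ≤ (LF : ℝ) at this; linarith
  have hlL : CL ≤ l := by have := LF.2; change 0 ≤ (LF : ℝ) at this; linarith
  set A : Set ℝ := {x | ∃ t ∈ Icc 0 T, x = |p₁ t - p₂ t| * Real.exp (-(l * t))} with hA
  have hAb : BddAbove A := by
    refine ⟨2 * P, ?_⟩
    rintro x ⟨t, ht, rfl⟩
    have h3 : |p₁ t - p₂ t| ≤ 2 * P := by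
      have a := hP₁ t
      have b := hP₂ t
      rw [clamped_of_mem ht] at a b
      exact (abs_sub _ _).trans (by linarith)
    have h4 : Real.exp (-(l * t)) ≤ 1 := Real.exp_le_one_iff.2 (by
      have := mul_nonneg hl0.le ht.1; linarith)
    exact (mul_le_of_le_one_right (abs_nonneg _) h4).trans h3
  set D := sSup A with hDdef
  have hmem : |p₁ 0 - p₂ 0| * Real.exp (-(l * 0)) ∈ A := ⟨0, ⟨le_rfl, hT.le⟩, rfl⟩
  have hD0 : 0 ≤ D := le_trans (by positivity) (le_csSup hAb hmem)
  have hDle : ∀ t ∈ Icc 0 T, |p₁ t - p₂ t| ≤ D * Real.exp (l * t) := by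
    intro t ht
    have := le_csSup hAb ⟨t, ht, rfl⟩
    rwa [Real.exp_neg, ← div_eq_mul_inv, div_le_iff₀ (Real.exp_pos _)] at this
  have hDle' : ∀ t ∈ Icc 0 T, |(-p₁) t - (-p₂) t| ≤ D * Real.exp (l * t) := fun t ht => by
    rw [Pi.neg_apply, Pi.neg_apply, neg_sub_neg, abs_sub_comm]
    exact hDle t ht
  have hRD := hR l hlR D hD0 hDle
  have hLD := hLe l hlL D hD0 hDle'
  set g : ℝ → ℝ := fun s => clamped p₁ T s - clamped p₂ T s with hg
  have hgL : LipschitzWith (L + L) g := hL₁.sub hL₂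
  have hg0 : g 0 = 0 := by
    have h0 : (0 : ℝ) ∈ Icc 0 T := ⟨le_rfl, hT.le⟩
    simp only [hg]
    rw [clamped_of_mem h0, clamped_of_mem h0, h₁.velocity_zero, h₂.velocity_zero, sub_self]
  have hgd : ∀ᵐ t : ℝ, t ∈ Ioo 0 T → |deriv g t| ≤ K * D * Real.exp (l * t) := by
    filter_upwards [hRD, hLD, h₁.velocity_deriv, h₂.velocity_deriv] with t hr hle d₁ d₂ ht
    have ht' : t ∈ Icc 0 T := Ioo_subset_Icc_self ht
    have hgt : HasDerivAt g (F (η₁ t) t - drag η₁ p₁ f₁ t - (F (η₂ t) t - drag η₂ p₂ f₂ t)) t := by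
      refine ((d₁ ht.1).fun_sub (d₂ ht.1)).congr_of_eventuallyEq ?_
      filter_upwards [Icc_mem_nhds ht.1 ht.2] with s hs
      simp only [hg]
      rw [clamped_of_mem hs, clamped_of_mem hs]
    rw [hgt.deriv]
    have hFd : |F (η₁ t) t - F (η₂ t) t| ≤ LF * (D * Real.exp (l * t)) := by
      have h1 := (hLF t ht.1.le).dist_le_mul (η₁ t) (η₂ t)
      rw [Real.dist_eq, Real.dist_eq] at h1
      refine h1.trans (mul_le_mul_of_nonneg_left ?_ LF.2)
      refine (abs_position_sub_le h₁ h₂ hl0 hD0 hDle ht').trans ?_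
      gcongr
      exact div_le_self (Real.exp_pos _).le hl1
    have hr2 := (hr (Ioo_subset_Ioc_self ht)).2
    have hl2 := (hle (Ioo_subset_Ioc_self ht)).2
    rw [dragR_reflect, dragR_reflect] at hl2
    unfold drag
    rw [abs_le] at hFd hr2 hl2 ⊢
    have e : K * D * Real.exp (l * t) = LF * (D * Real.exp (l * t)) +
      CR * D * Real.exp (l * t) + CL * D * Real.exp (l * t) := by rw [hK]; ring
    constructor <;> linarith [hFd.1, hFd.2, hr2.1, hr2.2, hl2.1, hl2.2]
  have hDself : D ≤ D / 2 := by
    refine csSup_le ⟨_, hmem⟩ ?_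
    rintro x ⟨t, ht, rfl⟩
    have h1 := abs_le_of_deriv_le hgL hg0 hl0 (by positivity) hgd ht
    simp only [hg] at h1
    rw [clamped_of_mem ht, clamped_of_mem ht] at h1
    rw [Real.exp_neg, ← div_eq_mul_inv, div_le_iff₀ (Real.exp_pos _)]
    refine h1.trans ?_
    have h2 : K / l ≤ 1 / 2 := by rw [div_le_iff₀ hl0]; linarith
    calc K * D * (Real.exp (l * t) / l) = K / l * (D * Real.exp (l * t)) := by ring
      _ ≤ 1 / 2 * (D * Real.exp (l * t)) := by gcongr
      _ = _ := by ring
  have hDz : D = 0 := by linarith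
  refine ⟨fun t ht => ?_, ?_⟩
  · have := hDle t ht
    rw [hDz, zero_mul] at this
    exact sub_eq_zero.1 (abs_nonpos_iff.1 this)
  · rw [hDz] at hRD hLD
    filter_upwards [hRD, hLD] with t hr hle ht
    have a := (hr ht).1
    have b := (hle ht).1
    rw [mul_zero, zero_mul, abs_nonpos_iff, sub_eq_zero] at a b
    exact ⟨a.symm, b.symm⟩

end Uniqueness

end GasDisk

theorem theorem1p1 (φ₀ : ℝ → ℝ) (hφ₁ : MemLp φ₀ 1 volume) (hφ₂ : MemLp φ₀ ⊤ volume)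
    (F : ℝ → ℝ → ℝ) (hF : ∃ L : NNReal, ∀ t : ℝ, 0 ≤ t → LipschitzWith L (fun x => F x t))
    (p₀ : ℝ) (η₁ p₁ η₂ p₂ : ℝ → ℝ) (f₁ f₂ : ℝ → ℝ → ℝ → ℝ)
    (h₁ : GasDisk.IsSolution φ₀ F p₀ η₁ p₁ f₁) (h₂ : GasDisk.IsSolution φ₀ F p₀ η₂ p₂ f₂) :
    (∀ t : ℝ, 0 ≤ t → η₁ t = η₂ t ∧ p₁ t = p₂ t) ∧
      ∀ t : ℝ, 0 ≤ t → ∀ᵐ z : ℝ × ℝ, f₁ z.1 z.2 t = f₂ z.1 z.2 t := by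
  obtain ⟨φ, B, hφm, hφB, hφi, hφ⟩ := GasDisk.exists_bounded_representative hφ₁ hφ₂
  have huniq := fun {T : ℝ} (hT : 0 < T) =>
    GasDisk.velocity_unique hφm hφB hφi hφ hF h₁ h₂ hT
  have hp : ∀ t, 0 ≤ t → p₁ t = p₂ t := fun t ht =>
    (huniq (show 0 < t + 1 by linarith)).1 t ⟨ht, by linarith⟩
  have hη : ∀ t, 0 ≤ t → η₁ t = η₂ t := fun t ht => by
    -- The velocities agree, so the estimate is used with `D = 0`; the weight `l = 1` is arbitrary.
    have := GasDisk.abs_position_sub_le (T := t) h₁ h₂ one_pos le_rfl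
      (fun s hs => by rw [hp s hs.1]; simp) ⟨ht, le_rfl⟩
    rw [zero_mul] at this
    exact sub_eq_zero.1 (abs_nonpos_iff.1 this)
  have hJ : ∀ᵐ t : ℝ, 0 < t → GasDisk.inflow η₂ p₂ f₂ t = GasDisk.inflow η₁ p₁ f₁ t ∧
      GasDisk.inflow (-η₂) (-p₂) (GasDisk.reflect f₂) t =
        GasDisk.inflow (-η₁) (-p₁) (GasDisk.reflect f₁) t := by
    have hall : ∀ᵐ t : ℝ, ∀ n : ℕ, t ∈ Ioc (0 : ℝ) (n + 1) →
        GasDisk.inflow η₂ p₂ f₂ t = GasDisk.inflow η₁ p₁ f₁ t ∧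
        GasDisk.inflow (-η₂) (-p₂) (GasDisk.reflect f₂) t =
          GasDisk.inflow (-η₁) (-p₁) (GasDisk.reflect f₁) t :=
      ae_all_iff.2 fun n => (huniq (by positivity)).2
    filter_upwards [hall] with t ht h0
    obtain ⟨n, hn⟩ := exists_nat_ge t
    exact ht n ⟨h0, by linarith⟩
  refine ⟨fun t ht => ⟨hη t ht, hp t ht⟩, fun t ht => ?_⟩
  rcases ht.eq_or_lt with rfl | h0
  · filter_upwards [h₁.initial, h₂.initial] with z e₁ e₂
    rw [e₁, e₂]
  · have hright := GasDisk.ae_density_eq (h₁.isRightGas hφ) (h₂.isRightGas hφ) hη hp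
      (hJ.mono fun t ht h => (ht h).1) h0
    have hleft := GasDisk.ae_density_eq (h₁.isRightGas_reflect hφ) (h₂.isRightGas_reflect hφ)
      (fun s hs => congrArg Neg.neg (hη s hs)) (fun s hs => congrArg Neg.neg (hp s hs))
      (hJ.mono fun t ht h => (ht h).2) h0
    have hleft' := (Measure.measurePreserving_neg
      (volume : Measure (ℝ × ℝ))).quasiMeasurePreserving.ae hleft
    -- The one-sided results leave out the position of the disk, a null set at fixed `t`.
    have hne : ∀ᵐ z : ℝ × ℝ, z.1 ≠ η₁ t :=
      Measure.quasiMeasurePreserving_fst.ae (Measure.ae_ne volume (η₁ t))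
    filter_upwards [hright, hleft', hne] with z hr hl hz
    rcases lt_or_gt_of_ne hz with h | h
    · have := hl (by simpa using h)
      simpa [GasDisk.reflect] using this
    · exact hr h
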